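/- **Setting.** A plumbing graph $\Gamma$ is a finite simple graph (not necessarily connected, cycles allowed, all genera zero) with a totally ordered vertex set $\mathcal J$, $|\mathcal J|=s$, and integer decorations $e_j$. Let $L=\mathbb Z\langle E_j\rangle_{j\in\mathcal J}$ with the intersection form $(E_j,E_j)=e_j$ and, for $i\ne j$, $(E_i,E_j)=1$ or $0$ according to whether $(i,j)$ is an edge or not; $\Gamma$ is *non-degenerate* if the determinant of this form is non-zero. Let $L'=\{l'\in L\otimes\mathbb Q:(l',L)\subset\mathbb Z\}$, let $E_j^*\in L'$ be given by $(E_j^*,E_i)=-\delta_{ij}$, and let $Char=\{k\in L':-\tfrac12(k+l,l)\in\mathbb Z\text{ for all }l\in L\}$. Put $w(k)=-(k^2+s)/8$ and, for $I\subset\mathcal J$, $E_I=\sum_{j\in I}E_j$ and $w(k,I)=\max_{I'\subset I}w(k+2E_{I'})$. The $q$-cubes are the pairs $(k,I)\in Char\times\mathcal P(\mathcal J)$ with $|I|=q$. Let $\mathcal T_0^+=\mathbb Z[U,U^{-1}]/U\mathbb Z[U]$, and let $\mathcal F^q(\Gamma)$ be the $\mathbb Z[U]$-module of finitely supported functions from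 the $q$-cubes to $\mathcal T_0^+$, extended to combinations of cubes with coefficients in $\mathbb Z[U]$ by $\mathbb Z[U]$-linearity. Let $(\delta\phi)(\square)=\phi(\partial\square)$ with, for $I=\{j_1<\dots<j_q\}$, $$\partial(k,I)=\sum_{l=1}^q(-1)^l\Big(U^{w(k,I)-w(k,I\setminus j_l)}(k,I\setminus j_l)-U^{w(k,I)-w(k+2E_{j_l},I\setminus j_l)}(k+2E_{j_l},I\setminus j_l)\Big).$$ $\mathbb H^q(\Gamma)$ denotes the cohomology of the complex $(\mathcal F^*(\Gamma),\delta)$ (with $q\ge0$). Fix a vertex $j_0$. $\Gamma\setminus j_0$ is $\Gamma$ with $j_0$ and its adjacent edges deleted; $\Gamma_{j_0}^+$ is $\Gamma$ with $e_{j_0}$ replaced by $e_{j_0}+1$; $\Gamma^b$ is $\Gamma$ with a new vertex $j_{new}$ (the largest one in the ordering), of decoration $-1$, attached to $j_0$ by one new edge. *The map $\overline B^*:\mathcal F^*(\Gamma)\to\mathcal F^*(\Gamma\setminus j_0)$.* Fix a representative $r_{[k]}$ of every orbit $[k]=k+2L(\Gamma\setminus j_0)$ in $Char(\Gamma\setminus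 j_0)$. Let $b(\sum a_jE^*_{j,\Gamma\setminus j_0})=\sum a_jE^*_{j,\Gamma}$, and let $R:L'(\Gamma)\to L'(\Gamma\setminus j_0)$ be linear with $R(E^*_{j,\Gamma})=E^*_{j,\Gamma\setminus j_0}$ for $j\ne j_0$ and $R(E^*_{j_0,\Gamma})=0$. Then $(\overline B^q\phi)(k,I)=\sum_{a\equiv e_{j_0}(2)}(-1)^{n(k,a)/2}\,\phi(b(k)+aE^*_{j_0,\Gamma},I)$, where $n(k,a)=(k-r_{[k]},R(E_{j_0}))+a+e_{j_0}$. *The map $A^*:\mathcal F^*(\Gamma_{j_0}^+)\to\mathcal F^*(\Gamma)$.* Let $\pi_*:L(\Gamma^b)\otimes\mathbb Q\to L(\Gamma_{j_0}^+)\otimes\mathbb Q$ be linear with $\pi_*E_j=E_j$ and $\pi_*E_{new}=0$. Define $\pi_*^c:\mathcal F^*(\Gamma_{j_0}^+)\to\mathcal F^*(\Gamma^b)$ by $(\pi_*^c\phi)(k',I)=U^{w_{\Gamma^b}(k',I)-w_{\Gamma_{j_0}^+}(\pi_*k',I)}\phi(\pi_*k',I)$ if $j_{new}\notin I$, and $0$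 otherwise. Define $B^*:\mathcal F^*(\Gamma^b)\to\mathcal F^*(\Gamma)$ by $(B^q\phi)(k,I)=\sum_{a\equiv1(2)}\phi(b^b(k)+aE^*_{new,\Gamma^b},I)$, where $b^b(\sum a_jE^*_{j,\Gamma})=\sum a_jE^*_{j,\Gamma^b}$. Put $A^*=B^*\circ\pi_*^c$. **Theorem.** Let $\Gamma$ be a plumbing graph and $j_0$ a vertex such that $\Gamma_{j_0}^+$, $\Gamma$ and $\Gamma\setminus j_0$ are non-degenerate. Then, for every choice of the representatives $r_{[k]}$, $A^*$ and $\overline B^*$ are morphisms of complexes of $\mathbb Z[U]$-modules, and $$0\to\mathcal F^*(\Gamma_{j_0}^+)\xrightarrow{A^*}\mathcal F^*(\Gamma)\xrightarrow{\overline B^*}\mathcal F^*(\Gamma\setminus j_0)\to0$$ is a short exact sequence of complexes. Consequently, with the connecting homomorphisms $\mathbb C^q$ of this sequence, there is a long exact sequence of $\mathbb Z[U]$-modules $$0\to\mathbb H^0(\Gamma_{j_0}^+)\to\cdots\to\mathbb H^q(\Gamma_{j_0}^+)\xrightarrow{\mathbb A^q}\mathbb H^q(\Gamma)\xrightarrow{\overline{\mathbb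 B}^q}\mathbb H^q(\Gamma\setminus j_0)\xrightarrow{\mathbb C^q}\mathbb H^{q+1}(\Gamma_{j_0}^+)\to\cdots .$$ -/

import Mathlib

noncomputable section

open Polynomial LaurentPolynomial CategoryTheory

/-- A finite plumbing graph (all genera zero, no loops, no multiple edges): a simple graph on the
vertex set `J` with an integer decoration (Euler number) at every vertex. -/
structure PlumbingGraph (J : Type*) where
  graph : SimpleGraph J
  e : J → ℤ

namespace PlumbingGraph

universe u

section Lattice

variable {J : Type*} [Fintype J] [LinearOrder J]

open Classical in
/-- The matrix of the intersection form in the basis `E_j`. -/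
def form (Γ : PlumbingGraph J) : Matrix J J ℤ :=
  Matrix.of fun i j => if i = j then Γ.e i else if Γ.graph.Adj i j then 1 else 0

/-- The intersection form has non-zero determinant. -/
def Nondegenerate (Γ : PlumbingGraph J) : Prop := Γ.form.det ≠ 0

/-- The intersection matrix over `ℚ`. -/
def formQ (Γ : PlumbingGraph J) : Matrix J J ℚ := Γ.form.map (Int.cast : ℤ → ℚ)

/-- The intersection form `(x, y)` on `L ⊗ ℚ`; vectors of `L ⊗ ℚ` are given by their coordinates
in the basis `E_j`. -/
def pairing (Γ : PlumbingGraph J) : LinearMap.BilinForm ℚ (J → ℚ) := Matrix.toBilin' Γ.formQ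

/-- The basis vector `E_j` of `L`, seen in `L ⊗ ℚ`. -/
def E (j : J) : J → ℚ := Pi.single j 1

/-- The inclusion of `L = ℤ^J` in `L ⊗ ℚ`. -/
def lat (l : J → ℤ) : J → ℚ := fun j => (l j : ℚ)

/-- `E_I = ∑_{j ∈ I} E_j`. -/
def EI (I : Finset J) : J → ℚ := ∑ j ∈ I, E j

/-- The dual vector `E_j^*`, characterized (for a non-degenerate form) by
`(E_j^*, E_i) = -δ_{ij}`: minus the `j`-th column of the inverse intersection matrix. -/
def Edual (Γ : PlumbingGraph J) (j : J) : J → ℚ := fun i => -(Γ.formQ⁻¹ i j)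

/-- The dual lattice `L' = {l' ∈ L ⊗ ℚ : (l', L) ⊆ ℤ}`. -/
def dualLattice (Γ : PlumbingGraph J) : Set (J → ℚ) :=
  {x | ∀ l : J → ℤ, ∃ n : ℤ, Γ.pairing x (lat l) = n}

/-- `χ_k(l) = -(k + l, l) / 2`. -/
def chi (Γ : PlumbingGraph J) (k l : J → ℚ) : ℚ := -(1 / 2) * Γ.pairing (k + l) l

/-- The set of characteristic elements. -/
def Char (Γ : PlumbingGraph J) : Set (J → ℚ) :=
  {k | k ∈ Γ.dualLattice ∧ ∀ l : J → ℤ, ∃ n : ℤ, Γ.chi k (lat l) = n}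

/-- The weight `w(k) = -(k² + s) / 8`, where `s` is the number of vertices. -/
def weight (Γ : PlumbingGraph J) (k : J → ℚ) : ℚ := -(Γ.pairing k k + Fintype.card J) / 8

/-- The weight of the cube `(k, I)`: the maximum of `w(k + 2 E_{I'})` over `I' ⊆ I`. -/
def cubeWeight (Γ : PlumbingGraph J) (k : J → ℚ) (I : Finset J) : ℚ :=
  I.powerset.sup' ⟨∅, Finset.empty_mem_powerset I⟩ fun I' => Γ.weight (k + (2 : ℚ) • EI I')

/-- `k ~ k'` if and only if `k' ∈ k + 2L`. -/
def orbitSetoid (Γ : PlumbingGraph J) : Setoid Γ.Char where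
  r k k' := ∃ l : J → ℤ, (k' : J → ℚ) = k + (2 : ℚ) • lat l
  iseqv :=
    { refl := fun k => ⟨0, by ext; simp [lat]⟩
      symm := by
        rintro k k' ⟨l, hl⟩
        refine ⟨-l, ?_⟩
        rw [hl]; ext; simp [lat]
      trans := by
        rintro k k' k'' ⟨l, hl⟩ ⟨m, hm⟩
        refine ⟨l + m, ?_⟩
        rw [hm, hl]; ext; simp [lat]; ring }

/-- A choice of a representative `r_{[k]} ∈ [k]` for every orbit `[k] = k + 2L ⊆ Char`. -/
structure OrbitRep (Γ : PlumbingGraph J) where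
  rep : Quotient Γ.orbitSetoid → Γ.Char
  spec : ∀ c, Quotient.mk Γ.orbitSetoid (rep c) = c

theorem form_symm (Γ : PlumbingGraph J) (i j : J) : Γ.form i j = Γ.form j i := by
  simp only [form, Matrix.of_apply]
  by_cases h : i = j
  · subst h; rfl
  · rw [if_neg h, if_neg (Ne.symm h)]
    by_cases h' : Γ.graph.Adj i j
    · rw [if_pos h', if_pos h'.symm]
    · rw [if_neg h', if_neg fun h'' => h' h''.symm]

theorem form_of_adj (Γ : PlumbingGraph J) {i j : J} (h : Γ.graph.Adj i j) : Γ.form i j = 1 := by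
  simp [form, h, h.ne]

theorem form_of_not_adj (Γ : PlumbingGraph J) {i j : J} (hij : i ≠ j) (h : ¬Γ.graph.Adj i j) :
    Γ.form i j = 0 := by
  simp [form, h, hij]

theorem pairing_apply (Γ : PlumbingGraph J) (x y : J → ℚ) :
    Γ.pairing x y = ∑ i, ∑ j, x i * (Γ.form i j : ℚ) * y j := by
  simp [pairing, formQ, Matrix.toBilin'_apply]

theorem pairing_comm (Γ : PlumbingGraph J) (x y : J → ℚ) : Γ.pairing x y = Γ.pairing y x := by
  rw [pairing_apply, pairing_apply, Finset.sum_comm]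
  refine Finset.sum_congr rfl fun i _ => Finset.sum_congr rfl fun j _ => ?_
  rw [form_symm]; ring

theorem pairing_E (Γ : PlumbingGraph J) (x : J → ℚ) (j : J) :
    Γ.pairing x (E j) = ∑ i, x i * (Γ.form i j : ℚ) := by
  rw [pairing_apply]
  refine Finset.sum_congr rfl fun i _ => ?_
  rw [Finset.sum_eq_single j] <;> simp +contextual [E]

theorem pairing_E_E (Γ : PlumbingGraph J) (i j : J) : Γ.pairing (E i) (E j) = Γ.form i j := by
  rw [pairing_E, Finset.sum_eq_single i] <;> simp +contextual [E]

theorem Nondegenerate.isUnit {Γ : PlumbingGraph J} (h : Γ.Nondegenerate) :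
    IsUnit Γ.formQ.det := by
  have : Γ.formQ.det = (Γ.form.det : ℚ) := by
    have := Int.cast_det (R := ℚ) Γ.form
    rw [this]; rfl
  rw [this, isUnit_iff_ne_zero]
  exact_mod_cast h

theorem Nondegenerate.pairing_Edual {Γ : PlumbingGraph J} (h : Γ.Nondegenerate) (i j : J) :
    Γ.pairing (Γ.Edual j) (E i) = if i = j then -1 else 0 := by
  have h1 := congrFun (congrFun (Matrix.mul_nonsing_inv Γ.formQ h.isUnit) i) j
  rw [Matrix.mul_apply, Matrix.one_apply] at h1
  rw [pairing_E]
  have : ∑ l, Γ.Edual j l * (Γ.form l i : ℚ) = -∑ l, Γ.formQ i l * Γ.formQ⁻¹ l j := by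
    rw [← Finset.sum_neg_distrib]
    refine Finset.sum_congr rfl fun l _ => ?_
    simp only [Edual, formQ, Matrix.map_apply]
    rw [form_symm Γ l i]; ring
  rw [this, h1]
  split_ifs <;> simp

theorem Nondegenerate.ext {Γ : PlumbingGraph J} (h : Γ.Nondegenerate) {x y : J → ℚ}
    (hxy : ∀ j, Γ.pairing x (E j) = Γ.pairing y (E j)) : x = y := by
  have hv : Matrix.vecMul x Γ.formQ = Matrix.vecMul y Γ.formQ := by
    ext j
    have := hxy j
    rw [pairing_E, pairing_E] at this
    simpa [Matrix.vecMul, dotProduct, formQ] using this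
  have := congrArg (fun z => Matrix.vecMul z Γ.formQ⁻¹) hv
  simpa [Matrix.vecMul_vecMul, Matrix.mul_nonsing_inv _ h.isUnit] using this

theorem lat_single (j : J) : lat (Pi.single j 1 : J → ℤ) = E j := by
  ext i
  by_cases h : i = j
  · subst h; simp [lat, E]
  · simp [lat, E, h]

theorem lat_add (l m : J → ℤ) : lat (l + m) = lat l + lat m := by ext; simp [lat]

theorem lat_neg (l : J → ℤ) : lat (-l) = -lat l := by ext; simp [lat]

theorem EI_eq_lat (I : Finset J) : EI I = lat (∑ j ∈ I, Pi.single j (1 : ℤ)) := by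
  ext i
  simp [EI, lat, E, Finset.sum_apply, Pi.single_apply]

theorem pairing_lat_lat (Γ : PlumbingGraph J) (l m : J → ℤ) :
    ∃ n : ℤ, Γ.pairing (lat l) (lat m) = n :=
  ⟨∑ i, ∑ j, l i * Γ.form i j * m j, by rw [pairing_apply]; simp [lat]⟩

theorem form_self (Γ : PlumbingGraph J) (j : J) : Γ.form j j = Γ.e j := by simp [form]

theorem mem_Char_iff (Γ : PlumbingGraph J) (k : J → ℚ) :
    k ∈ Γ.Char ↔ ∀ j, ∃ n : ℤ, Γ.pairing k (E j) = Γ.e j + 2 * n := by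
  constructor
  · rintro ⟨-, h⟩ j
    obtain ⟨n, hn⟩ := h (Pi.single j 1)
    rw [lat_single, chi, map_add, LinearMap.add_apply, pairing_E_E, form_self] at hn
    exact ⟨-n - Γ.e j, by push_cast; linarith⟩
  · intro h
    let P : AddSubgroup (J → ℤ) :=
      { carrier := {l | (∃ n : ℤ, Γ.pairing k (lat l) = n) ∧ ∃ n : ℤ, Γ.chi k (lat l) = n}
        zero_mem' := by
          have : lat (0 : J → ℤ) = 0 := by ext; simp [lat]
          simp only [Set.mem_ofPred_eq, this, chi, map_zero]
          exact ⟨⟨0, by simp⟩, ⟨0, by simp⟩⟩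
        add_mem' := by
          rintro l m ⟨⟨a, ha⟩, b, hb⟩ ⟨⟨c, hc⟩, d, hd⟩
          obtain ⟨n, hn⟩ := Γ.pairing_lat_lat l m
          have hn' := hn
          rw [pairing_comm] at hn'
          refine ⟨⟨a + c, by rw [lat_add, map_add, ha, hc]; push_cast; rfl⟩, b + d - n, ?_⟩
          simp only [chi, lat_add, map_add, LinearMap.add_apply] at hb hd ⊢
          push_cast
          linarith
        neg_mem' := by
          rintro l ⟨⟨a, ha⟩, b, hb⟩
          obtain ⟨n, hn⟩ := Γ.pairing_lat_lat l l
          refine ⟨⟨-a, by rw [lat_neg, map_neg, ha]; push_cast; rfl⟩, -b - n, ?_⟩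
          simp only [chi, lat_neg, map_add, map_neg, LinearMap.add_apply, LinearMap.neg_apply]
            at hb ⊢
          push_cast
          linarith }
    have hP : ∀ j, (Pi.single j 1 : J → ℤ) ∈ P := by
      intro j
      obtain ⟨n, hn⟩ := h j
      refine ⟨⟨Γ.e j + 2 * n, by rw [lat_single, hn]; push_cast; rfl⟩, -Γ.e j - n, ?_⟩
      rw [lat_single, chi, map_add, LinearMap.add_apply, pairing_E_E, form_self, hn]
      push_cast; ring
    have hall : ∀ l : J → ℤ, l ∈ P := by
      intro l
      have : l = ∑ j, l j • (Pi.single j 1 : J → ℤ) := by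
        ext i; simp [Finset.sum_apply, Pi.single_apply]
      rw [this]
      exact sum_mem fun j _ => zsmul_mem (hP j) _
    exact ⟨fun l => (hall l).1, fun l => (hall l).2⟩

theorem weight_add (Γ : PlumbingGraph J) (k x : J → ℚ) :
    Γ.weight (k + (2 : ℚ) • x) = Γ.weight k + Γ.chi k x := by
  simp only [weight, chi, map_add, map_smul, LinearMap.add_apply, LinearMap.smul_apply,
    smul_eq_mul, Γ.pairing_comm x k]
  ring

theorem shift_mem (Γ : PlumbingGraph J) {k : J → ℚ} (hk : k ∈ Γ.Char) (j : J) :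
    k + (2 : ℚ) • E j ∈ Γ.Char := by
  rw [mem_Char_iff] at hk ⊢
  intro i
  obtain ⟨n, hn⟩ := hk i
  refine ⟨n + Γ.form j i, ?_⟩
  rw [map_add, map_smul, LinearMap.add_apply, LinearMap.smul_apply, pairing_E_E, hn, smul_eq_mul]
  push_cast; ring

/-- The characteristic element `k + 2 E_j`. -/
def shift (Γ : PlumbingGraph J) (k : Γ.Char) (j : J) : Γ.Char :=
  ⟨k + (2 : ℚ) • E j, Γ.shift_mem k.2 j⟩

/-- `w` of a cube and of its initial vertex differ by an integer. -/
theorem cubeWeight_int (Γ : PlumbingGraph J) (k : Γ.Char) (I : Finset J) :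
    ∃ n : ℤ, Γ.cubeWeight k I = Γ.weight k + n := by
  obtain ⟨I', -, h⟩ := Finset.exists_mem_eq_sup' (s := I.powerset)
    ⟨∅, Finset.empty_mem_powerset I⟩ fun I' => Γ.weight ((k : J → ℚ) + (2 : ℚ) • EI I')
  obtain ⟨n, hn⟩ := k.2.2 (∑ j ∈ I', Pi.single j (1 : ℤ))
  refine ⟨n, ?_⟩
  rw [cubeWeight, h, weight_add, EI_eq_lat, hn]

theorem cubeWeight_erase_le (Γ : PlumbingGraph J) (k : J → ℚ) (I : Finset J) (j : J) :
    Γ.cubeWeight k (I.erase j) ≤ Γ.cubeWeight k I :=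
  Finset.sup'_mono _ (Finset.powerset_mono.2 (Finset.erase_subset _ _)) _

theorem cubeWeight_shift_erase_le (Γ : PlumbingGraph J) (k : J → ℚ) {I : Finset J} {j : J}
    (hj : j ∈ I) : Γ.cubeWeight (k + (2 : ℚ) • E j) (I.erase j) ≤ Γ.cubeWeight k I := by
  refine Finset.sup'_le _ _ fun I' hI' => ?_
  rw [Finset.mem_powerset] at hI'
  have hj' : j ∉ I' := fun h => Finset.notMem_erase j I (hI' h)
  have : k + (2 : ℚ) • E j + (2 : ℚ) • EI I' = k + (2 : ℚ) • EI (insert j I') := by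
    rw [EI, EI, Finset.sum_insert hj', smul_add, add_assoc]
  rw [this]
  refine Finset.le_sup' (fun I' => Γ.weight (k + (2 : ℚ) • EI I')) ?_
  rw [Finset.mem_powerset]
  exact Finset.insert_subset hj (hI'.trans (Finset.erase_subset _ _))

end Lattice

section Complex

/-- The submodule `U ℤ[U]` of `ℤ[U, U⁻¹]`. -/
def tSub : Submodule ℤ[X] ℤ[T;T⁻¹] := Submodule.span ℤ[X] {LaurentPolynomial.T 1}

/-- The `ℤ[U]`-module `𝒯₀⁺ = ℤ[U, U⁻¹] / U ℤ[U]`; the variable `U` is the polynomial variable `X`. -/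
abbrev Tower : Type := ℤ[T;T⁻¹] ⧸ tSub

/-- The power `U^x`, used only for exponents `x` that are non-negative integers. -/
def Upow (x : ℚ) : ℤ[X] := X ^ ⌊x⌋₊

theorem Upow_mul {x y : ℚ} (hx : 0 ≤ x) (hy : 0 ≤ y) (hx' : ∃ n : ℤ, x = n) :
    Upow x * Upow y = Upow (x + y) := by
  obtain ⟨n, rfl⟩ := hx'
  lift n to ℕ using (by exact_mod_cast hx)
  rw [Upow, Upow, Upow, ← pow_add, Int.cast_natCast, add_comm ((n : ℕ) : ℚ) y,
    Nat.floor_add_natCast hy, Nat.floor_natCast, add_comm]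

/-- Every element of `𝒯₀⁺` is killed by a power of `U`. -/
theorem tower_torsion (t : Tower) : ∃ N : ℕ, ∀ n, N ≤ n → (X ^ n : ℤ[X]) • t = 0 := by
  obtain ⟨f, rfl⟩ := Submodule.Quotient.mk_surjective _ t
  obtain ⟨n, f', hf⟩ := LaurentPolynomial.exists_T_pow f
  refine ⟨n + 1, fun m hm => ?_⟩
  obtain ⟨d, rfl⟩ := Nat.exists_eq_add_of_le hm
  rw [← Submodule.Quotient.mk_smul, Submodule.Quotient.mk_eq_zero]
  refine Submodule.mem_span_singleton.2 ⟨X ^ d * f', ?_⟩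
  change Polynomial.toLaurent _ * _ = Polynomial.toLaurent _ * _
  rw [map_mul, map_pow, map_pow, Polynomial.toLaurent_X, hf, LaurentPolynomial.T_pow,
    LaurentPolynomial.T_pow]
  have : (LaurentPolynomial.T (((n + 1 + d : ℕ) : ℤ) * 1) : ℤ[T;T⁻¹]) =
      LaurentPolynomial.T ((d : ℤ) * 1) * LaurentPolynomial.T n * LaurentPolynomial.T 1 := by
    rw [← LaurentPolynomial.T_add, ← LaurentPolynomial.T_add]
    congr 1; push_cast; ring
  rw [this]; ring

variable {J : Type u} [Fintype J] [LinearOrder J]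

/-- The set `𝒬_q` of `q`-cubes: pairs `(k, I)` with `k ∈ Char` and `I ⊆ J`, `|I| = q`. The cube
`(k, I)` has the vertices `k + 2 E_{I'}`, `I' ⊆ I`. -/
abbrev Cube (Γ : PlumbingGraph J) (q : ℕ) : Type u := {c : Γ.Char × Finset J // c.2.card = q}

/-- The cochain module `ℱ^q`: finitely supported functions from the `q`-cubes to `𝒯₀⁺`. -/
abbrev Cochain (Γ : PlumbingGraph J) (q : ℕ) : Type u := Γ.Cube q →₀ Tower

variable {Γ : PlumbingGraph J} {q : ℕ}

/-- The value `φ((k, I))` of a `q`-cochain; it is defined to be `0` if `|I| ≠ q`. -/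
def ev (φ : Γ.Cochain q) (k : Γ.Char) (I : Finset J) : Tower :=
  if h : I.card = q then φ ⟨(k, I), h⟩ else 0

theorem ev_of_card (φ : Γ.Cochain q) (c : Γ.Cube q) : φ c = ev φ c.1.1 c.1.2 := by
  rw [ev, dif_pos c.2]

theorem ev_add (φ ψ : Γ.Cochain q) (k : Γ.Char) (I : Finset J) :
    ev (φ + ψ) k I = ev φ k I + ev ψ k I := by
  unfold ev; split_ifs <;> simp

theorem ev_smul (p : ℤ[X]) (φ : Γ.Cochain q) (k : Γ.Char) (I : Finset J) :
    ev (p • φ) k I = p • ev φ k I := by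
  unfold ev; split_ifs <;> simp

theorem ev_finite (φ : Γ.Cochain q) :
    {c : Γ.Char × Finset J | ev φ c.1 c.2 ≠ 0}.Finite := by
  refine (φ.support.finite_toSet.image Subtype.val).subset ?_
  rintro ⟨k, I⟩ h
  change ev φ k I ≠ 0 at h
  unfold ev at h
  split_ifs at h with hc
  · exact ⟨⟨(k, I), hc⟩, by simpa using h, rfl⟩
  · exact absurd rfl h

/-- The sign `(-1)^l`, where `j` is the `l`-th element of `I` (counted from `1`). -/
def sgn (I : Finset J) (j : J) : ℤ := (-1) ^ (I.filter (· ≤ j)).card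

/-- The value of `δφ` at the cube `(k, I)`, that is, the value of `φ` at
`∂(k, I) = ∑_l (-1)^l (U^{w(k,I) - w(k,I∖j_l)} (k, I∖j_l)
  - U^{w(k,I) - w(k+2E_{j_l},I∖j_l)} (k + 2E_{j_l}, I∖j_l))`. -/
def deltaVal (φ : Γ.Cochain q) (k : Γ.Char) (I : Finset J) : Tower :=
  ∑ j ∈ I, sgn I j •
    (Upow (Γ.cubeWeight k I - Γ.cubeWeight k (I.erase j)) • ev φ k (I.erase j) -
      Upow (Γ.cubeWeight k I - Γ.cubeWeight (Γ.shift k j) (I.erase j)) •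
        ev φ (Γ.shift k j) (I.erase j))

theorem shift_injective (j : J) : Function.Injective fun k : Γ.Char => Γ.shift k j := by
  intro k k' h
  exact Subtype.ext (add_right_cancel (congrArg Subtype.val h))

theorem erase_injOn (j : J) :
    Set.InjOn (fun c : Γ.Char × Finset J => (c.1, c.2.erase j)) {c | j ∈ c.2} := by
  rintro ⟨k, I⟩ hI ⟨k', I'⟩ hI' h
  simp only [Prod.mk.injEq] at h
  have : I = I' := by
    have := congrArg (insert j) h.2
    rwa [Finset.insert_erase hI, Finset.insert_erase hI'] at this
  rw [h.1, this]

theorem deltaVal_finite (φ : Γ.Cochain q) :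
    (Function.support fun c : Γ.Cube (q + 1) => deltaVal φ c.1.1 c.1.2).Finite := by
  have h1 : ∀ j : J, {c : Γ.Char × Finset J | j ∈ c.2 ∧ ev φ c.1 (c.2.erase j) ≠ 0}.Finite := by
    intro j
    refine Set.Finite.of_finite_image (f := fun c : Γ.Char × Finset J => (c.1, c.2.erase j))
      ((ev_finite φ).subset ?_) ((erase_injOn j).mono fun c hc => hc.1)
    rintro _ ⟨c, hc, rfl⟩
    exact hc.2
  have h2 : ∀ j : J, {c : Γ.Char × Finset J |
      j ∈ c.2 ∧ ev φ (Γ.shift c.1 j) (c.2.erase j) ≠ 0}.Finite := by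
    intro j
    refine Set.Finite.of_finite_image
      (f := fun c : Γ.Char × Finset J => (Γ.shift c.1 j, c.2.erase j))
      ((ev_finite φ).subset ?_) ?_
    · rintro _ ⟨c, hc, rfl⟩
      exact hc.2
    · rintro ⟨k, I⟩ hI ⟨k', I'⟩ hI' h
      simp only [Prod.mk.injEq] at h
      refine erase_injOn j hI.1 hI'.1 ?_
      rw [Prod.mk.injEq]
      exact ⟨shift_injective j h.1, h.2⟩
  refine Set.Finite.of_finite_image (f := Subtype.val)
    ((Set.finite_iUnion fun j => (h1 j).union (h2 j)).subset ?_) Subtype.val_injective.injOn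
  rintro _ ⟨c, hc, rfl⟩
  obtain ⟨j, hj, hne⟩ := Finset.exists_ne_zero_of_sum_ne_zero hc
  refine Set.mem_iUnion.2 ⟨j, ?_⟩
  by_contra hcon
  rw [Set.mem_union, not_or] at hcon
  have e1 : ev φ c.1.1 (c.1.2.erase j) = 0 := by
    by_contra h; exact hcon.1 ⟨hj, h⟩
  have e2 : ev φ (Γ.shift c.1.1 j) (c.1.2.erase j) = 0 := by
    by_contra h; exact hcon.2 ⟨hj, h⟩
  exact hne (by rw [e1, e2]; simp)

/-- The coboundary `δ : ℱ^q → ℱ^{q+1}`, a `ℤ[U]`-linear map. -/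
def delta (Γ : PlumbingGraph J) (q : ℕ) : Γ.Cochain q →ₗ[ℤ[X]] Γ.Cochain (q + 1) where
  toFun φ := Finsupp.ofSupportFinite (fun c => deltaVal φ c.1.1 c.1.2) (deltaVal_finite φ)
  map_add' φ ψ := by
    ext c
    simp only [Finsupp.ofSupportFinite_coe, Finsupp.coe_add, Pi.add_apply, deltaVal, ev_add,
      ← Finset.sum_add_distrib]
    refine Finset.sum_congr rfl fun j _ => ?_
    simp only [smul_add, smul_sub]; abel
  map_smul' p φ := by
    ext c
    simp only [Finsupp.ofSupportFinite_coe, Finsupp.coe_smul, Pi.smul_apply, deltaVal, ev_smul,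
      Finset.smul_sum, RingHom.id_apply]
    refine Finset.sum_congr rfl fun j _ => ?_
    simp only [smul_sub, smul_comm p]

theorem ev_delta (φ : Γ.Cochain q) (k : Γ.Char) {I : Finset J} (hI : I.card = q + 1) :
    ev (Γ.delta q φ) k I = deltaVal φ k I := by
  rw [ev, dif_pos hI]; rfl

theorem sgn_swap {I : Finset J} {i j : J} (hi : i ∈ I) (hj : j ∈ I) (hij : i ≠ j) :
    sgn I j * sgn (I.erase j) i = -(sgn I i * sgn (I.erase i) j) := by
  wlog h : i < j generalizing i j
  · rw [this hj hi hij.symm (lt_of_le_of_ne (not_lt.1 h) hij.symm), neg_neg]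
  have e1 : (I.erase j).filter (· ≤ i) = I.filter (· ≤ i) := by
    rw [← Finset.erase_eq_of_notMem (s := I.filter (· ≤ i)) (a := j) (by simp [h]),
      Finset.filter_erase]
  have e2 : (I.filter (· ≤ j)).card = ((I.erase i).filter (· ≤ j)).card + 1 := by
    rw [Finset.filter_erase, Finset.card_erase_add_one]
    simp [hi, h.le]
  simp only [sgn, e1, e2, pow_succ]
  ring

/-- The exponents of `U` that occur in `δ` are non-negative integers. -/
theorem exp_int (k : Γ.Char) (I I' : Finset J) :
    ∃ n : ℤ, Γ.cubeWeight k I - Γ.cubeWeight k I' = n := by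
  obtain ⟨a, ha⟩ := Γ.cubeWeight_int k I
  obtain ⟨b, hb⟩ := Γ.cubeWeight_int k I'
  exact ⟨a - b, by rw [ha, hb]; push_cast; ring⟩

theorem weight_shift_int (k : Γ.Char) (j : J) : ∃ n : ℤ, Γ.weight (Γ.shift k j) = Γ.weight k + n := by
  obtain ⟨n, hn⟩ := k.2.2 (Pi.single j 1)
  exact ⟨n, by rw [shift, weight_add, ← lat_single, hn]⟩

theorem exp_shift_int (k : Γ.Char) (j : J) (I I' : Finset J) :
    ∃ n : ℤ, Γ.cubeWeight k I - Γ.cubeWeight (Γ.shift k j) I' = n := by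
  obtain ⟨a, ha⟩ := Γ.cubeWeight_int k I
  obtain ⟨b, hb⟩ := Γ.cubeWeight_int (Γ.shift k j) I'
  obtain ⟨c, hc⟩ := weight_shift_int k j
  exact ⟨a - b - c, by rw [ha, hb, hc]; push_cast; ring⟩

theorem shift_comm (k : Γ.Char) (i j : J) :
    Γ.shift (Γ.shift k i) j = Γ.shift (Γ.shift k j) i :=
  Subtype.ext (add_right_comm _ _ _)

theorem delta_delta (φ : Γ.Cochain q) : Γ.delta (q + 1) (Γ.delta q φ) = 0 := by
  ext ⟨⟨k, I⟩, hI⟩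
  change deltaVal (Γ.delta q φ) k I = 0
  replace hI : I.card = q + 1 + 1 := hI
  let V : Γ.Char → Finset J → Tower := fun k' I' =>
    Upow (Γ.cubeWeight k I - Γ.cubeWeight k' I') • ev φ k' I'
  have key : deltaVal (Γ.delta q φ) k I = ∑ j ∈ I, ∑ i ∈ I.erase j,
      (sgn I j * sgn (I.erase j) i) •
        (V k ((I.erase j).erase i) - V (Γ.shift k i) ((I.erase j).erase i)
          - (V (Γ.shift k j) ((I.erase j).erase i)
            - V (Γ.shift (Γ.shift k j) i) ((I.erase j).erase i))) := by
    refine Finset.sum_congr rfl fun j hj => ?_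
    have hc : (I.erase j).card = q + 1 := by rw [Finset.card_erase_of_mem hj, hI]; rfl
    rw [ev_delta _ _ hc, ev_delta _ _ hc, deltaVal, deltaVal, Finset.smul_sum, Finset.smul_sum,
      ← Finset.sum_sub_distrib, Finset.smul_sum]
    refine Finset.sum_congr rfl fun i hi => ?_
    rw [smul_comm (Upow _) (sgn (I.erase j) i), smul_comm (Upow _) (sgn (I.erase j) i), ← smul_sub,
      ← mul_smul]
    congr 1
    simp only [smul_sub, ← mul_smul]
    have f1 := sub_nonneg.2 (Γ.cubeWeight_erase_le k I j)
    have f2 : 0 ≤ Γ.cubeWeight k I - Γ.cubeWeight (Γ.shift k j) (I.erase j) :=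
      sub_nonneg.2 (Γ.cubeWeight_shift_erase_le k hj)
    have f3 := fun k => sub_nonneg.2 (Γ.cubeWeight_erase_le k (I.erase j) i)
    have f4 : ∀ k : Γ.Char, 0 ≤ Γ.cubeWeight k (I.erase j) -
        Γ.cubeWeight (Γ.shift k i) ((I.erase j).erase i) :=
      fun k => sub_nonneg.2 (Γ.cubeWeight_shift_erase_le k hi)
    rw [Upow_mul f1 (f3 _) (exp_int _ _ _), Upow_mul f1 (f4 _) (exp_int _ _ _),
      Upow_mul f2 (f3 _) (exp_shift_int _ _ _ _), Upow_mul f2 (f4 _) (exp_shift_int _ _ _ _)]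
    simp only [sub_add_sub_cancel]
    rfl
  rw [key, Finset.sum_sigma']
  refine Finset.sum_involution (fun p _ => ⟨p.2, p.1⟩) ?_ ?_ ?_ ?_
  · rintro ⟨j, i⟩ h
    simp only [Finset.mem_sigma, Finset.mem_erase] at h
    rw [sgn_swap h.2.2 h.1 h.2.1, Finset.erase_right_comm (a := i) (b := j), shift_comm k i j,
      neg_smul, neg_add_eq_zero]
    congr 1
    abel
  · rintro ⟨j, i⟩ h _ heq
    simp only [Finset.mem_sigma, Finset.mem_erase] at h
    simp only [Sigma.mk.injEq] at heq
    exact h.2.1 heq.1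
  · rintro ⟨j, i⟩ h
    simp only [Finset.mem_sigma, Finset.mem_erase] at h ⊢
    exact ⟨h.2.2, h.2.1.symm, h.1⟩
  · rintro ⟨j, i⟩ h
    rfl

/-- The lattice cochain complex `(ℱ^*(Γ), δ)` of `ℤ[U]`-modules. -/
def latticeComplex (Γ : PlumbingGraph J) : CochainComplex (ModuleCat.{u} ℤ[X]) ℕ :=
  CochainComplex.of (fun q => ModuleCat.of ℤ[X] (Γ.Cochain q))
    (fun q => ModuleCat.ofHom (Γ.delta q)) fun q => by
      ext1; exact LinearMap.ext fun φ => delta_delta φ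

/-- The lattice cohomology `ℍ^q(Γ)`. -/
abbrev latticeCohomology (Γ : PlumbingGraph J) (q : ℕ) : ModuleCat.{u} ℤ[X] :=
  Γ.latticeComplex.homology q

/-- A family of `ℤ[U]`-linear maps commuting with `δ`, as a morphism of complexes. -/
def complexHom {J' : Type u} [Fintype J'] [LinearOrder J'] {Γ : PlumbingGraph J}
    {Γ' : PlumbingGraph J'} (f : ∀ q, Γ.Cochain q →ₗ[ℤ[X]] Γ'.Cochain q)
    (hf : ∀ q φ, Γ'.delta q (f q φ) = f (q + 1) (Γ.delta q φ)) :
    Γ.latticeComplex ⟶ Γ'.latticeComplex :=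
  CochainComplex.ofHom (fun q => ModuleCat.ofHom (f q)) fun q => by
    simp only [latticeComplex, CochainComplex.of_d]
    ext1; exact LinearMap.ext fun φ => hf q φ

end Complex

section Deletion

variable {J V : Type u} [Fintype J] [LinearOrder J] [Fintype V] [LinearOrder V]

/-- `Γ` is the graph obtained from `Δ` by deleting the vertex `v` and the edges adjacent to it;
`ι` is the (order preserving) inclusion of the vertex set of `Γ` in that of `Δ`. -/
structure IsVertexDeletion (Γ : PlumbingGraph J) (Δ : PlumbingGraph V) (v : V) (ι : J ↪o V) :
    Prop where
  range_eq : Set.range ι = {v}ᶜ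
  graph_eq : Γ.graph = Δ.graph.comap ι
  e_eq : ∀ j, Γ.e j = Δ.e (ι j)

/-- The operator `b : ∑_j a_j E^*_{j,Γ} ↦ ∑_j a_j E^*_{j,Δ}`; the coefficient of `l'` at `E_j^*` is
`a_j = -(l', E_j)`. -/
def bMap (Γ : PlumbingGraph J) (Δ : PlumbingGraph V) (ι : J ↪o V) (l' : J → ℚ) : V → ℚ :=
  ∑ j, (-Γ.pairing l' (E j)) • Δ.Edual (ι j)

/-- The restriction `R : L'(Δ) → L'(Γ)`, `R(E^*_{j,Δ}) = E^*_{j,Γ}` for `j ≠ v` and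
`R(E^*_{v,Δ}) = 0`. -/
def resMap (Γ : PlumbingGraph J) (Δ : PlumbingGraph V) (ι : J ↪o V) (l' : V → ℚ) : J → ℚ :=
  ∑ j, (-Δ.pairing l' (E (ι j))) • Γ.Edual j

variable {Γ : PlumbingGraph J} {Δ : PlumbingGraph V} {v : V} {ι : J ↪o V}

theorem IsVertexDeletion.ne (h : IsVertexDeletion Γ Δ v ι) (j : J) : ι j ≠ v := by
  have : ι j ∈ ({v}ᶜ : Set V) := h.range_eq ▸ Set.mem_range_self j
  simpa using this

theorem IsVertexDeletion.cases (h : IsVertexDeletion Γ Δ v ι) (x : V) : x = v ∨ ∃ j, ι j = x := by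
  by_cases hx : x = v
  · exact Or.inl hx
  · have : x ∈ Set.range ι := by rw [h.range_eq]; exact hx
    exact Or.inr this

theorem IsVertexDeletion.form_eq (h : IsVertexDeletion Γ Δ v ι) (i j : J) :
    Δ.form (ι i) (ι j) = Γ.form i j := by
  have hadj : Γ.graph.Adj i j ↔ Δ.graph.Adj (ι i) (ι j) := by
    rw [h.graph_eq, SimpleGraph.comap_adj]
  by_cases hij : i = j
  · subst hij; rw [form_self, form_self, h.e_eq]
  · have hij' : ι i ≠ ι j := fun h' => hij (ι.injective h')
    by_cases ha : Γ.graph.Adj i j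
    · rw [form_of_adj Γ ha, form_of_adj Δ (hadj.1 ha)]
    · rw [form_of_not_adj Γ hij ha, form_of_not_adj Δ hij' fun h' => ha (hadj.2 h')]

theorem pairing_lift_ι (h : IsVertexDeletion Γ Δ v ι) (hΔ : Δ.Nondegenerate) (k : J → ℚ) (a : ℚ)
    (i : J) : Δ.pairing (bMap Γ Δ ι k + a • Δ.Edual v) (E (ι i)) = Γ.pairing k (E i) := by
  simp only [bMap, map_add, map_sum, map_smul, LinearMap.add_apply, LinearMap.sum_apply,
    LinearMap.smul_apply, hΔ.pairing_Edual, smul_eq_mul, h.ne, ι.injective.eq_iff]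
  rw [Finset.sum_eq_single i] <;> simp +contextual [eq_comm]

theorem pairing_lift_v (h : IsVertexDeletion Γ Δ v ι) (hΔ : Δ.Nondegenerate) (k : J → ℚ) (a : ℚ) :
    Δ.pairing (bMap Γ Δ ι k + a • Δ.Edual v) (E v) = -a := by
  simp only [bMap, map_add, map_sum, map_smul, LinearMap.add_apply, LinearMap.sum_apply,
    LinearMap.smul_apply, hΔ.pairing_Edual, smul_eq_mul, (h.ne _).symm]
  simp

theorem lift_mem (h : IsVertexDeletion Γ Δ v ι) (hΔ : Δ.Nondegenerate) {k : J → ℚ}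
    (hk : k ∈ Γ.Char) {a : ℤ} (ha : a ≡ Δ.e v [ZMOD 2]) :
    bMap Γ Δ ι k + (a : ℚ) • Δ.Edual v ∈ Δ.Char := by
  rw [mem_Char_iff] at hk ⊢
  intro x
  rcases h.cases x with rfl | ⟨j, rfl⟩
  · obtain ⟨c, hc⟩ := ha.dvd
    refine ⟨c - Δ.e x, ?_⟩
    rw [pairing_lift_v h hΔ]
    have : (Δ.e x : ℚ) - a = 2 * c := by exact_mod_cast hc
    push_cast; linarith
  · rw [pairing_lift_ι h hΔ, ← h.e_eq]
    exact hk j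

/-- The characteristic element `b(k) + a E_v^*` of `Δ`, where `k ∈ Char(Γ)`, `a ≡ e_v (mod 2)`. -/
def lift (h : IsVertexDeletion Γ Δ v ι) (hΔ : Δ.Nondegenerate) (k : Γ.Char)
    (a : {a : ℤ // a ≡ Δ.e v [ZMOD 2]}) : Δ.Char :=
  ⟨bMap Γ Δ ι k + ((a : ℤ) : ℚ) • Δ.Edual v, lift_mem h hΔ k.2 a.2⟩

theorem lift_injective (h : IsVertexDeletion Γ Δ v ι) (hΔ : Δ.Nondegenerate)
    (hΓ : Γ.Nondegenerate) : Function.Injective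
      fun p : Γ.Char × {a : ℤ // a ≡ Δ.e v [ZMOD 2]} => lift h hΔ p.1 p.2 := by
  rintro ⟨k, a⟩ ⟨k', a'⟩ heq
  have heq' := congrArg Subtype.val heq
  simp only [lift] at heq'
  have h1 := congrArg (fun x => Δ.pairing x (E v)) heq'
  simp only [pairing_lift_v h hΔ] at h1
  have h2 : (k : J → ℚ) = k' := hΓ.ext fun j => by
    have := congrArg (fun x => Δ.pairing x (E (ι j))) heq'
    simpa only [pairing_lift_ι h hΔ] using this
  rw [Prod.mk.injEq]
  exact ⟨Subtype.ext h2, Subtype.ext (by exact_mod_cast neg_injective h1)⟩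

/-- The value at the cube `(k, I)` of `Γ` of the cochain dual to the operator
`(k, I) ↦ ∑_{a ≡ e_v (mod 2)} ε(k, a) (b(k) + a E_v^*, I)`; the sum has only finitely many non-zero
terms, as `φ` has finite support. -/
def bVal {q : ℕ} (h : IsVertexDeletion Γ Δ v ι) (hΔ : Δ.Nondegenerate) (ε : Γ.Char → ℤ → ℤ)
    (φ : Δ.Cochain q) (k : Γ.Char) (I : Finset J) : Tower :=
  ∑ᶠ a : {a : ℤ // a ≡ Δ.e v [ZMOD 2]}, ε k a • ev φ (lift h hΔ k a) (I.map ι.toEmbedding)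

theorem bVal_term_finite {q : ℕ} (h : IsVertexDeletion Γ Δ v ι) (hΔ : Δ.Nondegenerate)
    (hΓ : Γ.Nondegenerate) (φ : Δ.Cochain q) :
    {p : Γ.Char × Finset J × {a : ℤ // a ≡ Δ.e v [ZMOD 2]} |
      ev φ (lift h hΔ p.1 p.2.2) (p.2.1.map ι.toEmbedding) ≠ 0}.Finite := by
  refine Set.Finite.of_finite_image
    (f := fun p => (lift h hΔ p.1 p.2.2, p.2.1.map ι.toEmbedding))
    ((ev_finite φ).subset ?_) ?_
  · rintro _ ⟨p, hp, rfl⟩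
    exact hp
  · rintro ⟨k, I, a⟩ _ ⟨k', I', a'⟩ _ heq
    simp only [Prod.mk.injEq] at heq
    have h1 := lift_injective h hΔ hΓ (a₁ := (k, a)) (a₂ := (k', a')) heq.1
    rw [Prod.mk.injEq] at h1
    rw [h1.1, h1.2, Finset.map_injective _ heq.2]

theorem bVal_term_finite' {q : ℕ} (h : IsVertexDeletion Γ Δ v ι) (hΔ : Δ.Nondegenerate)
    (hΓ : Γ.Nondegenerate) (φ : Δ.Cochain q) (k : Γ.Char) (I : Finset J) :
    (Function.support fun a : {a : ℤ // a ≡ Δ.e v [ZMOD 2]} =>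
      ev φ (lift h hΔ k a) (I.map ι.toEmbedding)).Finite := by
  refine Set.Finite.of_finite_image (f := fun a => (k, I, a))
    ((bVal_term_finite h hΔ hΓ φ).subset ?_) ?_
  · rintro _ ⟨a, ha, rfl⟩
    exact ha
  · intro a _ a' _ heq
    simpa using heq

theorem bVal_finite {q : ℕ} (h : IsVertexDeletion Γ Δ v ι) (hΔ : Δ.Nondegenerate)
    (hΓ : Γ.Nondegenerate) (ε : Γ.Char → ℤ → ℤ) (φ : Δ.Cochain q) :
    (Function.support fun c : Γ.Cube q => bVal h hΔ ε φ c.1.1 c.1.2).Finite := by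
  refine Set.Finite.of_finite_image (f := Subtype.val)
    (((bVal_term_finite h hΔ hΓ φ).image fun p => (p.1, p.2.1)).subset ?_)
    Subtype.val_injective.injOn
  rintro _ ⟨c, hc, rfl⟩
  obtain ⟨a, ha⟩ : ∃ a : {a : ℤ // a ≡ Δ.e v [ZMOD 2]}, ε c.1.1 a •
      ev φ (lift h hΔ c.1.1 a) (c.1.2.map ι.toEmbedding) ≠ 0 := by
    by_contra! hcon
    exact hc (finsum_eq_zero_of_forall_eq_zero hcon)
  exact ⟨(c.1.1, c.1.2, a), right_ne_zero_of_smul ha, rfl⟩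

theorem smul_support_finite {ι' : Type*} {f : ι' → Tower} (hf : (Function.support f).Finite)
    (n : ι' → ℤ) : (Function.support fun a => n a • f a).Finite :=
  hf.subset fun _ ha => right_ne_zero_of_smul ha

/-- The dual operator `ℱ^q(Δ) → ℱ^q(Γ)` of
`(k, I) ↦ ∑_{a ≡ e_v (mod 2)} ε(k, a) (b(k) + a E_v^*, I)`. -/
def bOp (h : IsVertexDeletion Γ Δ v ι) (hΔ : Δ.Nondegenerate) (hΓ : Γ.Nondegenerate)
    (ε : Γ.Char → ℤ → ℤ) (q : ℕ) : Δ.Cochain q →ₗ[ℤ[X]] Γ.Cochain q where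
  toFun φ := Finsupp.ofSupportFinite (fun c => bVal h hΔ ε φ c.1.1 c.1.2)
    (bVal_finite h hΔ hΓ ε φ)
  map_add' φ ψ := by
    ext c
    simp only [Finsupp.ofSupportFinite_coe, Finsupp.coe_add, Pi.add_apply, bVal, ev_add, smul_add]
    exact finsum_add_distrib (smul_support_finite (bVal_term_finite' h hΔ hΓ φ _ _) _)
      (smul_support_finite (bVal_term_finite' h hΔ hΓ ψ _ _) _)
  map_smul' p φ := by
    ext c
    simp only [Finsupp.ofSupportFinite_coe, Finsupp.coe_smul, Pi.smul_apply, bVal, ev_smul,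
      RingHom.id_apply]
    rw [smul_finsum' p (smul_support_finite (bVal_term_finite' h hΔ hΓ φ _ _) _)]
    exact finsum_congr fun a => smul_comm _ _ _

theorem EI_map_pairing (h : IsVertexDeletion Γ Δ v ι) (I : Finset J) :
    Δ.pairing (EI (I.map ι.toEmbedding)) (EI (I.map ι.toEmbedding)) = Γ.pairing (EI I) (EI I) := by
  simp only [EI, Finset.sum_map, map_sum, LinearMap.sum_apply, pairing_E_E]
  refine Finset.sum_congr rfl fun i _ => Finset.sum_congr rfl fun j _ => ?_
  exact congrArg _ (h.form_eq _ _)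

theorem weight_map (h : IsVertexDeletion Γ Δ v ι) {K : V → ℚ} {k : J → ℚ}
    (hK : ∀ j, Δ.pairing K (E (ι j)) = Γ.pairing k (E j)) (I : Finset J) :
    Δ.weight (K + (2 : ℚ) • EI (I.map ι.toEmbedding)) =
      Γ.weight (k + (2 : ℚ) • EI I) + (Δ.weight K - Γ.weight k) := by
  have h1 : Δ.pairing K (EI (I.map ι.toEmbedding)) = Γ.pairing k (EI I) := by
    simp only [EI, Finset.sum_map, map_sum]
    exact Finset.sum_congr rfl fun j _ => hK j
  rw [weight_add, weight_add, chi, chi, map_add, map_add, LinearMap.add_apply,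
    LinearMap.add_apply, EI_map_pairing h, h1]
  ring

theorem cubeWeight_map (h : IsVertexDeletion Γ Δ v ι) {K : V → ℚ} {k : J → ℚ}
    (hK : ∀ j, Δ.pairing K (E (ι j)) = Γ.pairing k (E j)) (I : Finset J) :
    Δ.cubeWeight K (I.map ι.toEmbedding) =
      Γ.cubeWeight k I + (Δ.weight K - Γ.weight k) := by
  apply le_antisymm
  · refine Finset.sup'_le _ _ fun I' hI' => ?_
    obtain ⟨I₀, hI₀, rfl⟩ := Finset.subset_map_iff.1 (Finset.mem_powerset.1 hI')
    rw [weight_map h hK]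
    gcongr
    exact Finset.le_sup' (fun I' => Γ.weight (k + (2 : ℚ) • EI I')) (Finset.mem_powerset.2 hI₀)
  · rw [← le_sub_iff_add_le]
    refine Finset.sup'_le _ _ fun I' hI' => ?_
    rw [le_sub_iff_add_le, ← weight_map h hK]
    exact Finset.le_sup' (fun I' => Δ.weight (K + (2 : ℚ) • EI I'))
      (Finset.mem_powerset.2 (Finset.map_subset_map.2 (Finset.mem_powerset.1 hI')))

theorem sgn_map (ι : J ↪o V) (I : Finset J) (j : J) :
    sgn (I.map ι.toEmbedding) (ι j) = sgn I j := by
  rw [sgn, sgn, Finset.filter_map, Finset.card_map]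
  congr 3
  ext i
  simp

/-- The translation `a ↦ a + 2c` of the set of `a ≡ e (mod 2)`. -/
def parityShift (e c : ℤ) : {a : ℤ // a ≡ e [ZMOD 2]} ≃ {a : ℤ // a ≡ e [ZMOD 2]} where
  toFun a := ⟨a + 2 * c, by have := a.2; unfold Int.ModEq at *; omega⟩
  invFun a := ⟨a - 2 * c, by have := a.2; unfold Int.ModEq at *; omega⟩
  left_inv a := by ext; simp
  right_inv a := by ext; simp

theorem lift_shift (h : IsVertexDeletion Γ Δ v ι) (hΔ : Δ.Nondegenerate) (k : Γ.Char) (j : J)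
    (a : {a : ℤ // a ≡ Δ.e v [ZMOD 2]}) :
    lift h hΔ (Γ.shift k j) a =
      Δ.shift (lift h hΔ k (parityShift _ (Δ.form (ι j) v) a)) (ι j) := by
  refine Subtype.ext (hΔ.ext fun x => ?_)
  simp only [lift, shift, parityShift, Equiv.coe_fn_mk]
  rw [map_add _ (bMap _ _ _ _ + _), LinearMap.add_apply]
  rcases h.cases x with rfl | ⟨i, rfl⟩
  · rw [pairing_lift_v h hΔ, pairing_lift_v h hΔ, map_smul, LinearMap.smul_apply, pairing_E_E]
    push_cast [smul_eq_mul]; ring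
  · rw [pairing_lift_ι h hΔ, pairing_lift_ι h hΔ, map_add, LinearMap.add_apply, map_smul,
      LinearMap.smul_apply, map_smul, LinearMap.smul_apply, pairing_E_E, pairing_E_E, h.form_eq]

theorem bOp_comm (h : IsVertexDeletion Γ Δ v ι) (hΔ : Δ.Nondegenerate) (hΓ : Γ.Nondegenerate)
    (ε : Γ.Char → ℤ → ℤ)
    (hε : ∀ k j (a : ℤ), ε (Γ.shift k j) a = ε k (a + 2 * Δ.form (ι j) v))
    (q : ℕ) (φ : Δ.Cochain q) :
    Γ.delta q (bOp h hΔ hΓ ε q φ) = bOp h hΔ hΓ ε (q + 1) (Δ.delta q φ) := by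
  ext ⟨⟨k, I⟩, hI⟩
  change deltaVal (bOp h hΔ hΓ ε q φ) k I = bVal h hΔ ε (Δ.delta q φ) k I
  replace hI : I.card = q + 1 := hI
  have hfin := bVal_term_finite' h hΔ hΓ φ
  have hev : ∀ k {I : Finset J}, I.card = q → ev (bOp h hΔ hΓ ε q φ) k I = bVal h hΔ ε φ k I := by
    intro k I hI
    rw [ev, dif_pos hI]; rfl
  have hw : ∀ k a (I : Finset J), Δ.cubeWeight (lift h hΔ k a) (I.map ι.toEmbedding) =
      Γ.cubeWeight k I + (Δ.weight (lift h hΔ k a) - Γ.weight k) := fun k a I =>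
    cubeWeight_map h (fun j => pairing_lift_ι h hΔ k a j) I
  have hw' : ∀ k a j (I : Finset J),
      Δ.cubeWeight (Δ.shift (lift h hΔ k a) (ι j)) (I.map ι.toEmbedding) =
      Γ.cubeWeight (Γ.shift k j) I + (Δ.weight (lift h hΔ k a) - Γ.weight k) := by
    intro k a j I
    have e1 := lift_shift h hΔ k j ((parityShift _ (Δ.form (ι j) v)).symm a)
    rw [Equiv.apply_symm_apply] at e1
    rw [← e1, hw, e1]
    have e2 := weight_map h (K := lift h hΔ k a) (k := k)
      (fun j => pairing_lift_ι h hΔ k a j) {j}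
    simp only [EI, Finset.map_singleton, Finset.sum_singleton] at e2
    change Δ.weight (Δ.shift (lift h hΔ k a) (ι j)) = Γ.weight (Γ.shift k j) + _ at e2
    rw [e2]; ring
  have hd : ∀ a, ev (Δ.delta q φ) (lift h hΔ k a) (I.map ι.toEmbedding) = ∑ j ∈ I, sgn I j •
      (Upow (Γ.cubeWeight k I - Γ.cubeWeight k (I.erase j)) •
          ev φ (lift h hΔ k a) ((I.erase j).map ι.toEmbedding) -
        Upow (Γ.cubeWeight k I - Γ.cubeWeight (Γ.shift k j) (I.erase j)) •
          ev φ (Δ.shift (lift h hΔ k a) (ι j)) ((I.erase j).map ι.toEmbedding)) := by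
    intro a
    rw [ev_delta _ _ (by rw [Finset.card_map, hI]), deltaVal, Finset.sum_map]
    refine Finset.sum_congr rfl fun j _ => ?_
    rw [← Finset.map_erase]
    change sgn (I.map ι.toEmbedding) (ι j) • (_ - Upow (_ -
      Δ.cubeWeight (Δ.shift (lift h hΔ k a) (ι j)) _) • _) = _
    rw [sgn_map, hw, hw, hw', add_sub_add_right_eq_sub, add_sub_add_right_eq_sub]
    rfl
  have hsh : ∀ j (I' : Finset J), (fun a : {a : ℤ // a ≡ Δ.e v [ZMOD 2]} => ε (Γ.shift k j) a •
      ev φ (lift h hΔ (Γ.shift k j) a) (I'.map ι.toEmbedding)) =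
      fun a => (fun a' : {a : ℤ // a ≡ Δ.e v [ZMOD 2]} => ε k a' •
        ev φ (Δ.shift (lift h hΔ k a') (ι j)) (I'.map ι.toEmbedding))
        (parityShift _ (Δ.form (ι j) v) a) := by
    intro j I'
    funext a
    simp only [lift_shift, hε]
    rfl
  have hfin2 : ∀ j (I' : Finset J), (Function.support fun a : {a : ℤ // a ≡ Δ.e v [ZMOD 2]} => ε k a •
        ev φ (Δ.shift (lift h hΔ k a) (ι j)) (I'.map ι.toEmbedding)).Finite := by
    intro j I'
    have h1 := smul_support_finite (hfin (Γ.shift k j) I') (fun a => ε (Γ.shift k j) a)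
    rw [hsh] at h1
    have h2 := h1.image (parityShift _ (Δ.form (ι j) v))
    refine h2.subset fun a ha => ⟨(parityShift _ (Δ.form (ι j) v)).symm a, ?_, by simp⟩
    simpa using ha
  have hfin1 : ∀ (I' : Finset J), (Function.support fun a : {a : ℤ // a ≡ Δ.e v [ZMOD 2]} => ε k a •
        ev φ (lift h hΔ k a) (I'.map ι.toEmbedding)).Finite := fun I' =>
    smul_support_finite (hfin k I') _
  rw [deltaVal, bVal]
  simp only [hd, Finset.smul_sum]
  rw [finsum_sum_comm]
  · refine Finset.sum_congr rfl fun j hj => ?_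
    have hc : (I.erase j).card = q := by rw [Finset.card_erase_of_mem hj, hI]; rfl
    have hre : bVal h hΔ ε φ (Γ.shift k j) (I.erase j) =
        ∑ᶠ a : {a : ℤ // a ≡ Δ.e v [ZMOD 2]}, ε k a •
          ev φ (Δ.shift (lift h hΔ k a) (ι j)) ((I.erase j).map ι.toEmbedding) := by
      rw [bVal, hsh]
      exact finsum_comp_equiv (parityShift _ (Δ.form (ι j) v))
        (f := fun a' : {a : ℤ // a ≡ Δ.e v [ZMOD 2]} => ε k a' •
          ev φ (Δ.shift (lift h hΔ k a') (ι j)) ((I.erase j).map ι.toEmbedding))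
    rw [hev _ hc, hev _ hc, hre, bVal,
      smul_finsum' _ (hfin1 _), smul_finsum' _ (hfin2 _ _),
      ← finsum_sub_distrib, smul_finsum']
    · refine finsum_congr fun a => ?_
      simp only [smul_sub, smul_comm (ε k a)]
    · refine ((hfin1 (I.erase j)).union (hfin2 j (I.erase j))).subset fun a ha => ?_
      by_contra hcon
      rw [Set.mem_union, not_or] at hcon
      simp only [Function.mem_support, not_not] at hcon
      exact ha (by simp only [hcon.1, hcon.2, smul_zero, sub_zero])
    · exact (hfin1 _).subset fun a ha => right_ne_zero_of_smul ha
    · exact (hfin2 _ _).subset fun a ha => right_ne_zero_of_smul ha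
  · intro j _
    refine ((hfin1 (I.erase j)).union (hfin2 j (I.erase j))).subset fun a ha => ?_
    by_contra hcon
    rw [Set.mem_union, not_or] at hcon
    simp only [Function.mem_support, not_not] at hcon
    refine ha ?_
    simp only [smul_comm (ε k a), smul_sub, hcon.1, hcon.2, smul_zero, sub_zero]

/-- The morphism of complexes `B^* : ℱ^*(Δ) → ℱ^*(Γ)`, dual to
`B_q((k, I)) = ∑_{a ≡ e_v (mod 2)} (b(k) + a E_v^*, I)`. -/
def Bhom (h : IsVertexDeletion Γ Δ v ι) (hΔ : Δ.Nondegenerate) (hΓ : Γ.Nondegenerate) :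
    Δ.latticeComplex ⟶ Γ.latticeComplex :=
  complexHom (bOp h hΔ hΓ fun _ _ => 1) (bOp_comm h hΔ hΓ _ fun _ _ _ => rfl)

/-- `n(k, a) = (k - r_{[k]}, R(E_v)) + a + e_v`, an even integer. -/
def nVal (Γ : PlumbingGraph J) (Δ : PlumbingGraph V) (v : V) (ι : J ↪o V) (r : Γ.OrbitRep)
    (k : Γ.Char) (a : ℤ) : ℚ :=
  Γ.pairing ((k : J → ℚ) - (r.rep (Quotient.mk Γ.orbitSetoid k) : J → ℚ))
    (resMap Γ Δ ι (E v)) + a + Δ.e v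

/-- The sign `(-1)^{n(k, a) / 2}`. -/
def Bsign (Γ : PlumbingGraph J) (Δ : PlumbingGraph V) (v : V) (ι : J ↪o V) (r : Γ.OrbitRep)
    (k : Γ.Char) (a : ℤ) : ℤ :=
  (Int.negOnePow ⌊nVal Γ Δ v ι r k a / 2⌋ : ℤˣ)

theorem Bsign_shift (hΓ : Γ.Nondegenerate) (r : Γ.OrbitRep)
    (k : Γ.Char) (j : J) (a : ℤ) :
    Bsign Γ Δ v ι r (Γ.shift k j) a = Bsign Γ Δ v ι r k (a + 2 * Δ.form (ι j) v) := by
  have h1 : Quotient.mk Γ.orbitSetoid (Γ.shift k j) = Quotient.mk Γ.orbitSetoid k := by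
    refine Quotient.sound (Γ.orbitSetoid.symm' ?_)
    exact ⟨Pi.single j 1, by rw [lat_single]; rfl⟩
  have h2 : Γ.pairing (E j) (resMap Γ Δ ι (E v)) = Δ.form (ι j) v := by
    rw [Γ.pairing_comm]
    simp only [resMap, map_sum, map_smul, LinearMap.sum_apply, LinearMap.smul_apply,
      hΓ.pairing_Edual, pairing_E_E]
    rw [Finset.sum_eq_single j]
    · simp [form_symm Δ v]
    · intro i _ hi; simp [hi.symm]
    · simp
  have h3 : nVal Γ Δ v ι r (Γ.shift k j) a = nVal Γ Δ v ι r k (a + 2 * Δ.form (ι j) v) := by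
    simp only [nVal, h1]
    change Γ.pairing ((k : J → ℚ) + (2 : ℚ) • E j - _) _ + _ + _ = _
    rw [add_sub_right_comm, map_add, LinearMap.add_apply, map_smul, LinearMap.smul_apply, h2,
      smul_eq_mul]
    push_cast; ring
  rw [Bsign, Bsign, h3]

/-- The sign-modified morphism of complexes `B̄^* : ℱ^*(Δ) → ℱ^*(Γ)`, dual to
`B̄_q((k, I)) = ∑_{a ≡ e_v (mod 2)} (-1)^{n(k, a) / 2} (b(k) + a E_v^*, I)`. -/
def Bbarhom (h : IsVertexDeletion Γ Δ v ι) (hΔ : Δ.Nondegenerate) (hΓ : Γ.Nondegenerate)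
    (r : Γ.OrbitRep) : Δ.latticeComplex ⟶ Γ.latticeComplex :=
  complexHom (bOp h hΔ hΓ (Bsign Γ Δ v ι r))
    (bOp_comm h hΔ hΓ _ fun k j a => Bsign_shift hΓ r k j a)

end Deletion

section Surgery

variable {J : Type u} [Fintype J] [LinearOrder J]

/-- The graph `Γ ∖ j₀`: the vertex `j₀` and its adjacent edges are deleted. -/
def delete (Γ : PlumbingGraph J) (j₀ : J) : PlumbingGraph {j : J // j ≠ j₀} where
  graph := Γ.graph.comap Subtype.val
  e j := Γ.e j

/-- The decoration of the vertex `j₀` is modified from `e_{j₀}` to `e_{j₀} + m`. -/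
def addDecoration (Γ : PlumbingGraph J) (j₀ : J) (m : ℤ) : PlumbingGraph J where
  graph := Γ.graph
  e := Function.update Γ.e j₀ (Γ.e j₀ + m)

/-- The graph `Γ_{j₀}^+`: the decoration `e_{j₀}` is replaced by `e_{j₀} + 1`. -/
def plus (Γ : PlumbingGraph J) (j₀ : J) : PlumbingGraph J := Γ.addDecoration j₀ 1

/-- The graph `Γ^b`: a new vertex `j_new = ⊤` with decoration `-1` is attached to `j₀` by a single
new edge. The new vertex is the largest one in the ordering of the vertices. -/
def attach (Γ : PlumbingGraph J) (j₀ : J) : PlumbingGraph (WithTop J) where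
  graph := Γ.graph.map (WithTop.some : J → WithTop J) ⊔ SimpleGraph.edge (j₀ : WithTop J) ⊤
  e := WithTop.recTopCoe (-1) Γ.e

/-- The blow-up of `Γ` at the vertex `j₀`: a new vertex with decoration `-1` is attached to `j₀`,
and the decoration `e_{j₀}` is replaced by `e_{j₀} - 1`. -/
def blowUp (Γ : PlumbingGraph J) (j₀ : J) : PlumbingGraph (WithTop J) :=
  (Γ.addDecoration j₀ (-1)).attach j₀

theorem blowUp_plus (Γ : PlumbingGraph J) (j₀ : J) : Γ.attach j₀ = (Γ.plus j₀).blowUp j₀ := by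
  simp [blowUp, plus, addDecoration]

theorem delete_isVertexDeletion (Γ : PlumbingGraph J) (j₀ : J) :
    IsVertexDeletion (Γ.delete j₀) Γ j₀ (OrderEmbedding.subtype (· ≠ j₀)) where
  range_eq := by ext; simp
  graph_eq := rfl
  e_eq _ := rfl

theorem attach_adj_coe (Γ : PlumbingGraph J) (j₀ i j : J) :
    (Γ.attach j₀).graph.Adj i j ↔ Γ.graph.Adj i j := by
  simp only [attach, SimpleGraph.sup_adj, SimpleGraph.edge_adj]
  constructor
  · rintro (⟨-, a, b, hab, ha, hb⟩ | h)
    · rw [WithTop.coe_inj] at ha hb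
      subst ha hb
      exact hab
    · simp at h
  · intro h
    exact Or.inl ⟨by simpa using h.ne, i, j, h, rfl, rfl⟩

theorem attach_adj_top (Γ : PlumbingGraph J) (j₀ i : J) :
    (Γ.attach j₀).graph.Adj i ⊤ ↔ i = j₀ := by
  simp only [attach, SimpleGraph.sup_adj, SimpleGraph.edge_adj]
  constructor
  · rintro (⟨-, a, b, -, -, hb⟩ | h)
    · exact absurd hb WithTop.coe_ne_top
    · simpa using h
  · rintro rfl
    exact Or.inr (by simp)

theorem attach_isVertexDeletion (Γ : PlumbingGraph J) (j₀ : J) :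
    IsVertexDeletion Γ (Γ.attach j₀) ⊤ WithTop.coeOrderHom where
  range_eq := by ext x; induction x <;> simp
  graph_eq := by
    ext i j
    exact (attach_adj_coe Γ j₀ i j).symm
  e_eq _ := rfl

theorem attach_form_coe (Γ : PlumbingGraph J) (j₀ i j : J) :
    (Γ.attach j₀).form i j = Γ.form i j :=
  (attach_isVertexDeletion Γ j₀).form_eq i j

theorem attach_form_top (Γ : PlumbingGraph J) (j₀ i : J) :
    (Γ.attach j₀).form i ⊤ = if i = j₀ then 1 else 0 := by
  split_ifs with h
  · exact form_of_adj _ ((attach_adj_top Γ j₀ i).2 h)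
  · exact form_of_not_adj _ (WithTop.coe_ne_top) fun h' => h ((attach_adj_top Γ j₀ i).1 h')

theorem attach_form_top_top (Γ : PlumbingGraph J) (j₀ : J) : (Γ.attach j₀).form ⊤ ⊤ = -1 :=
  form_self _ _

theorem addDecoration_form (Γ : PlumbingGraph J) (j₀ : J) (m : ℤ) (i j : J) :
    (Γ.addDecoration j₀ m).form i j = Γ.form i j + if i = j₀ then (if j = j₀ then m else 0) else 0 := by
  by_cases hij : i = j
  · subst hij
    rw [form_self, form_self]
    by_cases h : i = j₀
    · subst h; simp [addDecoration]
    · simp [addDecoration, h]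
  · have h0 : (if i = j₀ then (if j = j₀ then m else 0) else 0) = 0 := by
      split_ifs with h1 h2
      · exact absurd (h1.trans h2.symm) hij
      · rfl
      · rfl
    rw [h0, add_zero]
    by_cases ha : Γ.graph.Adj i j
    · rw [form_of_adj Γ ha, form_of_adj (Γ.addDecoration j₀ m) ha]
    · rw [form_of_not_adj Γ hij ha, form_of_not_adj (Γ.addDecoration j₀ m) hij ha]

theorem sum_withTop (f : WithTop J → ℚ) : ∑ x, f x = f ⊤ + ∑ j : J, f j :=
  Fintype.sum_option f

/-- The extension over `ℚ` of the map `π_* : ∑ x_j E_j + x_new E_new ↦ ∑ x_j E_j`. -/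
def piStar (x : WithTop J → ℚ) : J → ℚ := fun j => x j

theorem attach_pairing (Γ : PlumbingGraph J) (j₀ : J) (x y : WithTop J → ℚ) :
    (Γ.attach j₀).pairing x y = Γ.pairing (piStar x) (piStar y)
      + x ⊤ * y j₀ + x j₀ * y ⊤ - x ⊤ * y ⊤ := by
  rw [pairing_apply, pairing_apply, sum_withTop]
  simp only [sum_withTop, attach_form_coe, attach_form_top, attach_form_top_top,
    form_symm (Γ.attach j₀) ⊤ (WithTop.some _), Finset.sum_add_distrib, piStar]
  simp
  ring

theorem addDecoration_pairing (Γ : PlumbingGraph J) (j₀ : J) (m : ℤ) (x y : J → ℚ) :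
    (Γ.addDecoration j₀ m).pairing x y = Γ.pairing x y + m * x j₀ * y j₀ := by
  rw [pairing_apply, pairing_apply]
  simp only [addDecoration_form, Int.cast_add, mul_add, add_mul, Finset.sum_add_distrib]
  congr 1
  rw [Finset.sum_eq_single j₀, Finset.sum_eq_single j₀]
  · rw [if_pos rfl, if_pos rfl]; ring
  · simp +contextual
  · simp
  · simp +contextual
  · simp

theorem blowUp_pairing (Γ : PlumbingGraph J) (j₀ : J) (x y : WithTop J → ℚ) :
    (Γ.blowUp j₀).pairing x y = Γ.pairing (piStar x) (piStar y)
      - (x ⊤ - x j₀) * (y ⊤ - y j₀) := by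
  rw [blowUp, attach_pairing, addDecoration_pairing]
  simp only [piStar]
  push_cast; ring

/-- If `Γ_{j₀}^+` is non-degenerate then so is its blow-up `Γ^b`. -/
theorem attach_nondegenerate {Γ : PlumbingGraph J} {j₀ : J} (h : (Γ.plus j₀).Nondegenerate) :
    (Γ.attach j₀).Nondegenerate := by
  intro hdet
  have hdet' : (Γ.attach j₀).formQ.det = 0 := by
    have := Int.cast_det (R := ℚ) (Γ.attach j₀).form
    rw [hdet, Int.cast_zero] at this
    exact this.symm
  obtain ⟨x, hx, hx0⟩ := Matrix.exists_vecMul_eq_zero_iff.2 hdet'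
  have hp : ∀ j, (Γ.attach j₀).pairing x (E j) = 0 := by
    intro j
    have := congrFun hx0 j
    rw [pairing_E]
    simpa [Matrix.vecMul, dotProduct, formQ] using this
  rw [blowUp_plus] at hp
  have htop : x ⊤ - x j₀ = 0 := by
    have := hp ⊤
    rw [blowUp_pairing] at this
    have e1 : piStar (E (⊤ : WithTop J)) = 0 := by ext j; simp [piStar, E]
    rw [e1] at this
    have h' : x j₀ - x ⊤ = 0 := by simpa [E] using this
    linarith
  have hpi : piStar x = 0 := h.ext fun j => by
    have := hp j
    rw [blowUp_pairing, htop, zero_mul, sub_zero] at this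
    have e1 : piStar (E (j : WithTop J)) = E j := by
      ext i
      by_cases hij : i = j
      · subst hij; simp [piStar, E]
      · simp [piStar, E, hij]
    rw [e1] at this
    rw [this]; simp
  apply hx
  ext y
  induction y with
  | top => have := congrFun hpi j₀; simp only [piStar, Pi.zero_apply] at this ⊢; linarith
  | coe j => exact congrFun hpi j

end Surgery

section BlowDown

variable {J : Type u} [Fintype J] [LinearOrder J] {Γ : PlumbingGraph J}
  {Γ' : PlumbingGraph (WithTop J)} {j₀ : J}

theorem piStar_E_coe (j : J) : piStar (E (j : WithTop J)) = E j := by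
  ext i
  by_cases hij : i = j
  · subst hij; simp [piStar, E]
  · simp [piStar, E, hij]

theorem piStar_E_top : piStar (E (⊤ : WithTop J)) = 0 := by ext j; simp [piStar, E]

theorem piStar_mem (h : Γ' = Γ.blowUp j₀) {k : WithTop J → ℚ} (hk : k ∈ Γ'.Char) :
    piStar k ∈ Γ.Char := by
  subst h
  have key : ∀ (x : WithTop J → ℚ) (l : J → ℤ), (Γ.blowUp j₀).pairing x
      (lat (WithTop.recTopCoe (l j₀) l)) = Γ.pairing (piStar x) (lat l) := by
    intro x l
    rw [blowUp_pairing]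
    have e1 : piStar (lat (WithTop.recTopCoe (l j₀) l)) = lat l := rfl
    rw [e1]
    simp [lat]
  refine ⟨fun l => ?_, fun l => ?_⟩
  · obtain ⟨n, hn⟩ := hk.1 (WithTop.recTopCoe (l j₀) l)
    exact ⟨n, by rw [← hn, key]⟩
  · obtain ⟨n, hn⟩ := hk.2 (WithTop.recTopCoe (l j₀) l)
    refine ⟨n, ?_⟩
    rw [← hn, chi, chi, key]
    rfl

/-- `π_* : Char(Γ') → Char(Γ)`, where `Γ'` is the blow-up of `Γ` at `j₀`. -/
def piChar (h : Γ' = Γ.blowUp j₀) (k : Γ'.Char) : Γ.Char := ⟨piStar k, piStar_mem h k.2⟩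

/-- The subset `I ∩ J` of `J`, for a set `I` of vertices of `Γ'`. -/
def down (I : Finset (WithTop J)) : Finset J :=
  I.preimage WithTop.some WithTop.coe_injective.injOn

/-- The inclusion of the vertices of `Γ` in those of `Γ'`. -/
abbrev up (I : Finset J) : Finset (WithTop J) := I.map WithTop.coeOrderHom.toEmbedding

/-- The value at the cube `(k, I)` of `Γ'` of the cochain `π_*^c φ = φ ∘ π_*^h`, where
`π_*^h((k, I)) = U^{w'(k, I) - w(π_* k, I)} (π_* k, I)` if `j_new ∉ I` and `0` otherwise. -/
def piVal {q : ℕ} (h : Γ' = Γ.blowUp j₀) (φ : Γ.Cochain q) (k : Γ'.Char)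
    (I : Finset (WithTop J)) : Tower :=
  if ⊤ ∈ I then 0 else
    Upow (Γ'.cubeWeight k I - Γ.cubeWeight (piChar h k) (down I)) • ev φ (piChar h k) (down I)

theorem down_up (I : Finset J) : down (up I) = I := by
  ext j; simp [down, up]

theorem top_notMem_up (I : Finset J) : ⊤ ∉ up I := by simp [up]

theorem exists_up {I : Finset (WithTop J)} (hI : ⊤ ∉ I) : ∃ I₀, I = up I₀ := by
  refine ⟨down I, ?_⟩
  ext x
  induction x with
  | top => simp [hI, up]
  | coe j => simp [up, down]

theorem weight_piStar (h : Γ' = Γ.blowUp j₀) (k : WithTop J → ℚ) :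
    Γ'.weight k = Γ.weight (piStar k) + ((k ⊤ - k j₀) ^ 2 - 1) / 8 := by
  subst h
  have : Fintype.card (WithTop J) = Fintype.card J + 1 := Fintype.card_option
  rw [weight, weight, blowUp_pairing, this]
  push_cast; ring

/-- For `k ∈ Char(Γ')` one has `k = π^* π_* k + a E_new` with an odd integer `a`. -/
theorem piStar_odd (h : Γ' = Γ.blowUp j₀) {k : WithTop J → ℚ} (hk : k ∈ Γ'.Char) :
    ∃ n : ℤ, k ⊤ - k j₀ = 2 * n + 1 := by
  obtain ⟨n, hn⟩ := (mem_Char_iff _ _).1 hk ⊤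
  have he : Γ'.e ⊤ = -1 := by subst h; rfl
  have hp : Γ'.pairing k (E ⊤) = -(k ⊤ - k j₀) := by
    subst h
    rw [blowUp_pairing, piStar_E_top]
    simp [E]
  rw [hp, he] at hn
  exact ⟨-n, by push_cast at hn ⊢; linarith⟩

theorem piStar_vertex (k : WithTop J → ℚ) (I : Finset J) :
    piStar (k + (2 : ℚ) • EI (up I)) = piStar k + (2 : ℚ) • EI I := by
  have : piStar (EI (up I)) = EI I := by
    ext j
    simp only [EI, Finset.sum_map, piStar, Finset.sum_apply]
    exact Finset.sum_congr rfl fun i _ => congrFun (piStar_E_coe i) j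
  rw [← this]; rfl

theorem odd_vertex (k : WithTop J → ℚ) (I : Finset J) :
    (k + (2 : ℚ) • EI (up I)) ⊤ - (k + (2 : ℚ) • EI (up I)) j₀ =
      k ⊤ - k j₀ - if j₀ ∈ I then 2 else 0 := by
  have h1 : EI (up I) ⊤ = 0 := by
    simp [EI, E, Finset.sum_apply, Pi.single_apply]
  have h2 : EI (up I) j₀ = if j₀ ∈ I then 1 else 0 := by
    simp [EI, E, Finset.sum_apply, Pi.single_apply]
  simp only [Pi.add_apply, Pi.smul_apply, h1, h2, smul_eq_mul]
  split_ifs <;> ring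

theorem pi_exp_ge (h : Γ' = Γ.blowUp j₀) (k : WithTop J → ℚ) (I : Finset J) :
    ∃ d : ℤ, (d = 0 ∨ d = 1) ∧ ((k ⊤ - k j₀ - 2 * d) ^ 2 - 1) / 8 ≤
      Γ'.cubeWeight k (up I) - Γ.cubeWeight (piStar k) I := by
  obtain ⟨I', hI', hmax⟩ := Finset.exists_mem_eq_sup' (s := I.powerset)
    ⟨∅, Finset.empty_mem_powerset I⟩ fun I' => Γ.weight (piStar k + (2 : ℚ) • EI I')
  have h1 : Γ'.weight (k + (2 : ℚ) • EI (up I')) ≤ Γ'.cubeWeight k (up I) :=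
    Finset.le_sup' (fun I' => Γ'.weight (k + (2 : ℚ) • EI I'))
      (Finset.mem_powerset.2 (Finset.map_subset_map.2 (Finset.mem_powerset.1 hI')))
  have h2 : Γ.cubeWeight (piStar k) I = Γ.weight (piStar k + (2 : ℚ) • EI I') := hmax
  rw [weight_piStar h, piStar_vertex, odd_vertex] at h1
  by_cases hj : j₀ ∈ I'
  · refine ⟨1, Or.inr rfl, ?_⟩
    rw [if_pos hj] at h1
    rw [h2]; push_cast; linarith
  · refine ⟨0, Or.inl rfl, ?_⟩
    rw [if_neg hj] at h1
    rw [h2]; push_cast; linarith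

theorem pi_exp_nonneg (h : Γ' = Γ.blowUp j₀) (k : Γ'.Char) (I : Finset J) :
    0 ≤ Γ'.cubeWeight k (up I) - Γ.cubeWeight (piChar h k) I := by
  obtain ⟨d, -, hd⟩ := pi_exp_ge h k I
  obtain ⟨n, hn⟩ := piStar_odd h k.2
  refine le_trans ?_ hd
  rw [hn]
  have h1 : (1 : ℤ) ≤ (2 * n + 1 - 2 * d) ^ 2 := by
    have : 2 * n + 1 - 2 * d ≠ 0 := by omega
    have := pow_pos (abs_pos.2 this) 2
    rw [sq_abs] at this
    omega
  have h2 : (1 : ℚ) ≤ (2 * n + 1 - 2 * d) ^ 2 := by exact_mod_cast h1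
  linarith

theorem pi_exp_int (h : Γ' = Γ.blowUp j₀) (k : Γ'.Char) (I : Finset (WithTop J)) (I' : Finset J) :
    ∃ n : ℤ, Γ'.cubeWeight k I - Γ.cubeWeight (piChar h k) I' = n := by
  obtain ⟨a, ha⟩ := Γ'.cubeWeight_int k I
  obtain ⟨b, hb⟩ := Γ.cubeWeight_int (piChar h k) I'
  obtain ⟨n, hn⟩ := piStar_odd h k.2
  obtain ⟨m, hm⟩ := Int.even_mul_succ_self n
  refine ⟨a - b + m, ?_⟩
  rw [ha, hb, weight_piStar h, hn]
  have : (n : ℚ) * (n + 1) = m + m := by exact_mod_cast hm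
  simp only [piChar]
  push_cast
  linear_combination this / 2

theorem piVal_finite {q : ℕ} (h : Γ' = Γ.blowUp j₀) (φ : Γ.Cochain q) :
    (Function.support fun c : Γ'.Cube q => piVal h φ c.1.1 c.1.2).Finite := by
  obtain ⟨N, hN⟩ : ∃ N : ℕ, ∀ k I, ∀ n, N ≤ n → (X ^ n : ℤ[X]) • ev φ k I = 0 := by
    choose M hM using tower_torsion
    refine ⟨φ.support.sup fun c => M (φ c), fun k I n hn => ?_⟩
    unfold ev
    split_ifs with hc
    · by_cases h0 : φ ⟨(k, I), hc⟩ = 0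
      · rw [h0, smul_zero]
      · exact hM _ _ (le_trans (Finset.le_sup (f := fun c => M (φ c))
          (Finsupp.mem_support_iff.2 h0)) hn)
    · rw [smul_zero]
  let S : Set ((Γ.Char × Finset J) × ℚ) := {c | ev φ c.1 c.2 ≠ 0} ×ˢ
    ((fun n : ℤ => (n : ℚ)) '' Set.Icc (-(8 * N + 4 : ℤ)) (8 * N + 4))
  have hS : S.Finite := (ev_finite φ).prod ((Set.finite_Icc _ _).image _)
  refine Set.Finite.of_finite_image
    (f := fun c : Γ'.Cube q => ((piChar h c.1.1, down c.1.2), c.1.1.1 ⊤ - c.1.1.1 j₀))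
    (hS.subset ?_) ?_
  · rintro _ ⟨⟨⟨k, I⟩, hI⟩, hc, rfl⟩
    change piVal h φ k I ≠ 0 at hc
    unfold piVal at hc
    split_ifs at hc with htop
    · exact absurd rfl hc
    · refine ⟨right_ne_zero_of_smul hc, ?_⟩
      obtain ⟨I₀, rfl⟩ := exists_up htop
      rw [down_up] at hc
      obtain ⟨n, hn⟩ := piStar_odd h k.2
      refine ⟨2 * n + 1, ?_, by push_cast; exact hn.symm⟩
      obtain ⟨d, hd, hge⟩ := pi_exp_ge h k I₀
      have hlt : ⌊Γ'.cubeWeight k (up I₀) - Γ.cubeWeight (piChar h k) I₀⌋₊ < N := by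
        by_contra hcon
        exact hc (hN _ _ _ (not_lt.1 hcon))
      rw [Nat.floor_lt (pi_exp_nonneg h k I₀)] at hlt
      have h1 : ((2 * n + 1 - 2 * d : ℤ) : ℚ) ^ 2 < ((8 * N + 1 : ℤ) : ℚ) := by
        have := lt_of_le_of_lt hge hlt
        rw [hn] at this
        push_cast
        linarith
      have h2 : (2 * n + 1 - 2 * d) ^ 2 < (8 * N + 1 : ℤ) := by exact_mod_cast h1
      rw [Set.mem_Icc]
      constructor <;> rcases hd with rfl | rfl <;> nlinarith
  · rintro ⟨⟨k, I⟩, hI⟩ hc ⟨⟨k', I'⟩, hI'⟩ hc' heq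
    have ht : ∀ {k I}, piVal h φ k I ≠ 0 → ⊤ ∉ I := fun h1 h2 => h1 (by simp [piVal, h2])
    obtain ⟨I₀, rfl⟩ := exists_up (ht hc)
    obtain ⟨I₁, rfl⟩ := exists_up (ht hc')
    simp only [Prod.mk.injEq, down_up] at heq
    obtain ⟨⟨h1, rfl⟩, h2⟩ := heq
    have h1' := congrArg Subtype.val h1
    simp only [piChar] at h1'
    have : k = k' := by
      ext x
      induction x with
      | top =>
        have := congrFun h1' j₀
        simp only [piStar] at this
        linarith
      | coe j => exact congrFun h1' j
    subst this
    rfl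

/-- The dual operator `π_*^c : ℱ^q(Γ) → ℱ^q(Γ')`. -/
def piOp (h : Γ' = Γ.blowUp j₀) (q : ℕ) : Γ.Cochain q →ₗ[ℤ[X]] Γ'.Cochain q where
  toFun φ := Finsupp.ofSupportFinite (fun c => piVal h φ c.1.1 c.1.2) (piVal_finite h φ)
  map_add' φ ψ := by
    ext c
    simp only [Finsupp.ofSupportFinite_coe, Finsupp.coe_add, Pi.add_apply, piVal, ev_add, smul_add]
    split_ifs <;> simp
  map_smul' p φ := by
    ext c
    simp only [Finsupp.ofSupportFinite_coe, Finsupp.coe_smul, Pi.smul_apply, piVal, ev_smul,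
      RingHom.id_apply]
    split_ifs
    · simp
    · rw [smul_comm]

theorem piOp_comm (h : Γ' = Γ.blowUp j₀) (q : ℕ) (φ : Γ.Cochain q) :
    Γ'.delta q (piOp h q φ) = piOp h (q + 1) (Γ.delta q φ) := by
  ext ⟨⟨k, I⟩, hI⟩
  change deltaVal (piOp h q φ) k I = piVal h (Γ.delta q φ) k I
  replace hI : I.card = q + 1 := hI
  have hev : ∀ k {I : Finset (WithTop J)}, I.card = q →
      ev (piOp h q φ) k I = piVal h φ k I := by
    intro k I hI
    rw [ev, dif_pos hI]; rfl
  have hup : ∀ k (I₀ : Finset J), piVal h φ k (up I₀) =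
      Upow (Γ'.cubeWeight k (up I₀) - Γ.cubeWeight (piChar h k) I₀) •
        ev φ (piChar h k) I₀ := by
    intro k I₀
    rw [piVal, if_neg (top_notMem_up I₀), down_up]
  have hsc : ∀ j : J, piChar h (Γ'.shift k j) = Γ.shift (piChar h k) j := by
    intro j
    apply Subtype.ext
    simp only [piChar, shift]
    have : piStar ((k : WithTop J → ℚ) + (2 : ℚ) • E (j : WithTop J)) =
      piStar (k : WithTop J → ℚ) + (2 : ℚ) • piStar (E (j : WithTop J)) := rfl
    rw [this, piStar_E_coe]
  have hst : piChar h (Γ'.shift k ⊤) = piChar h k := by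
    apply Subtype.ext
    simp only [piChar, shift]
    have : piStar ((k : WithTop J → ℚ) + (2 : ℚ) • E ⊤) =
      piStar (k : WithTop J → ℚ) + (2 : ℚ) • piStar (E ⊤) := rfl
    rw [this, piStar_E_top, smul_zero, add_zero]
  have hsle : ∀ {I : Finset (WithTop J)} {x : WithTop J}, x ∈ I →
      0 ≤ Γ'.cubeWeight k I - Γ'.cubeWeight (Γ'.shift k x) (I.erase x) := fun hx =>
    sub_nonneg.2 (Γ'.cubeWeight_shift_erase_le _ hx)
  by_cases htop : ⊤ ∈ I
  · rw [piVal, if_pos htop, deltaVal, Finset.sum_eq_single ⊤]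
    · have hc : (I.erase ⊤).card = q := by rw [Finset.card_erase_of_mem htop, hI]; rfl
      obtain ⟨I₀, hI₀⟩ := exists_up (Finset.notMem_erase ⊤ I)
      have hn := hsle htop
      have hn' := sub_nonneg.2 (Γ'.cubeWeight_erase_le k I ⊤)
      rw [hev _ hc, hev _ hc]
      rw [hI₀] at hn hn' ⊢
      rw [hup, hup, ← mul_smul, ← mul_smul,
        Upow_mul hn' (pi_exp_nonneg h k I₀) (exp_int _ _ _),
        Upow_mul hn (pi_exp_nonneg h _ I₀) (exp_shift_int _ _ _ _), hst, sub_add_sub_cancel,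
        sub_add_sub_cancel, sub_self, smul_zero]
    · intro x hx hxt
      have hc : (I.erase x).card = q := by rw [Finset.card_erase_of_mem hx, hI]; rfl
      have ht : ⊤ ∈ I.erase x := Finset.mem_erase.2 ⟨hxt.symm, htop⟩
      rw [hev _ hc, hev _ hc, piVal, piVal, if_pos ht, if_pos ht]
      simp
    · exact fun hc => absurd htop hc
  · obtain ⟨I₀, rfl⟩ := exists_up htop
    have hI₀ : I₀.card = q + 1 := by rw [← hI, Finset.card_map]
    rw [piVal, if_neg htop, down_up, ev_delta _ _ hI₀, deltaVal, deltaVal, Finset.sum_map,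
      Finset.smul_sum]
    refine Finset.sum_congr rfl fun j hj => ?_
    have hj' : (j : WithTop J) ∈ up I₀ := Finset.mem_map_of_mem _ hj
    have he : (up I₀).erase (j : WithTop J) = up (I₀.erase j) :=
      (Finset.map_erase WithTop.coeOrderHom.toEmbedding I₀ j).symm
    have hc : (up (I₀.erase j)).card = q := by
      rw [Finset.card_map, Finset.card_erase_of_mem hj, hI₀]; rfl
    have hn := hsle hj'
    have hn' := sub_nonneg.2 (Γ'.cubeWeight_erase_le k (up I₀) j)
    have hm : 0 ≤ Γ.cubeWeight (piChar h k) I₀ -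
        Γ.cubeWeight (Γ.shift (piChar h k) j) (I₀.erase j) :=
      sub_nonneg.2 (Γ.cubeWeight_shift_erase_le _ hj)
    have hm' := sub_nonneg.2 (Γ.cubeWeight_erase_le (piChar h k) I₀ j)
    change sgn (up I₀) (WithTop.coeOrderHom j) • (Upow (_ - Γ'.cubeWeight k
      ((up I₀).erase (j : WithTop J))) • ev (piOp h q φ) k ((up I₀).erase (j : WithTop J)) -
      Upow (_ - Γ'.cubeWeight (Γ'.shift k j) ((up I₀).erase (j : WithTop J))) •
        ev (piOp h q φ) (Γ'.shift k j) ((up I₀).erase (j : WithTop J))) = _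
    rw [he] at hn hn' ⊢
    rw [sgn_map, hev _ hc, hev _ hc, hup, hup, smul_comm (Upow _) (sgn I₀ j)]
    congr 1
    rw [smul_sub, ← mul_smul, ← mul_smul, ← mul_smul, ← mul_smul,
      Upow_mul hn' (pi_exp_nonneg h k _) (exp_int _ _ _),
      Upow_mul hn (pi_exp_nonneg h _ _) (exp_shift_int _ _ _ _),
      Upow_mul (pi_exp_nonneg h k _) hm' (pi_exp_int h _ _ _),
      Upow_mul (pi_exp_nonneg h k _) hm (pi_exp_int h _ _ _), hsc]
    simp only [sub_add_sub_cancel]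

/-- The morphism of complexes `π_*^c : ℱ^*(Γ) → ℱ^*(Γ')` for the blow-up `Γ'` of `Γ` at `j₀`. -/
def piHom (h : Γ' = Γ.blowUp j₀) : Γ.latticeComplex ⟶ Γ'.latticeComplex :=
  complexHom (piOp h) (piOp_comm h)

end BlowDown

section Main

variable {J : Type u} [Fintype J] [LinearOrder J] (Γ : PlumbingGraph J) (j₀ : J)

/-- The morphism `A^* = B^* ∘ π_*^c : ℱ^*(Γ_{j₀}^+) → ℱ^*(Γ^b) → ℱ^*(Γ)`, where `Γ^b` is `Γ` with a
new `(-1)`-vertex attached to `j₀`: it is the blow-up of `Γ_{j₀}^+` at `j₀`, and `Γ = Γ^b ∖ j_new`. -/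
def Ahom (hplus : (Γ.plus j₀).Nondegenerate) (hΓ : Γ.Nondegenerate) :
    (Γ.plus j₀).latticeComplex ⟶ Γ.latticeComplex :=
  piHom (Γ.blowUp_plus j₀) ≫
    Bhom (Γ.attach_isVertexDeletion j₀) (attach_nondegenerate hplus) hΓ

/-- The morphism `B̄^* : ℱ^*(Γ) → ℱ^*(Γ ∖ j₀)`; it depends on the choice of a representative in
every orbit `k + 2L(Γ ∖ j₀)` of characteristic elements of `Γ ∖ j₀`. -/
def BbarDelete (hΓ : Γ.Nondegenerate) (hdel : (Γ.delete j₀).Nondegenerate)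
    (r : (Γ.delete j₀).OrbitRep) : Γ.latticeComplex ⟶ (Γ.delete j₀).latticeComplex :=
  Bbarhom (Γ.delete_isVertexDeletion j₀) hΓ hdel r

end Main


end PlumbingGraph

end

/-!
The characteristic elements over a fixed `k ∈ Char(Γ ∖ j₀)` form a line indexed by `ℤ` in
`Char(Γ)` and another one in `Char(Γ_{j₀}^+)`. For fixed `k` and `I` the map `A^*` is a matrix
`(A φ)(d, I) = ∑ₛ U^{ε(d, s)} φ(s, I)` between these lines, and `B̄^*` is an alternating sum
over the line, taken only for `j₀ ∉ I`.

If `j₀ ∉ I` then `ε(d, s) = (s - d)(s - d + 1) / 2` is symmetric under `d ↦ 2s + 1 - d`, a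
reflection that flips the sign in `B̄^*`; hence `B̄^* A^* = 0`. All modules are `U`-power
torsion and `U`-divisible, so injectivity of `A^*` and exactness in the middle may be checked on
the kernel of `U`, where only the entries with `ε = 0` survive. If `j₀ ∉ I`, `A^*` becomes `δₛ ↦
δₛ + δₛ₊₁` there. If `j₀ ∈ I`, the line has a centre `C`, and `A^*` sends `δ_C` to `δ_C` and
every other `δₛ` to the sum of `δₛ` and its neighbour on the side of `C`. Both matrices are
injective; the second one is onto, and modulo the image of the first every cochain is
concentrated at `d = 0`, where `B̄^*` is the identity up to sign.
-/

noncomputable section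

open Polynomial LaurentPolynomial CategoryTheory

section PowTorsion

variable {R M N P : Type*} [Ring R] [AddCommGroup M] [Module R M] [AddCommGroup N] [Module R N]
  [AddCommGroup P] [Module R P] {r : R}

theorem injective_of_pow_torsion (f : M →ₗ[R] N) (hM : ∀ m : M, ∃ n : ℕ, r ^ n • m = 0)
    (hf : ∀ m : M, r • m = 0 → f m = 0 → m = 0) : Function.Injective f := by
  rw [injective_iff_map_eq_zero]
  intro m hm
  obtain ⟨n, hn⟩ := hM m
  induction n with
  | zero => rwa [pow_zero, one_smul] at hn
  | succ n ih =>
    refine ih (hf _ ?_ ?_)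
    · rw [← mul_smul, ← pow_succ', hn]
    · rw [map_smul, hm, smul_zero]

theorem exact_of_pow_torsion_of_divisible (f : M →ₗ[R] N) (g : N →ₗ[R] P)
    (hgf : ∀ m, g (f m) = 0) (hN : ∀ x : N, ∃ n : ℕ, r ^ n • x = 0)
    (hM : Function.Surjective fun m : M => r • m)
    (hex : ∀ x : N, r • x = 0 → g x = 0 → ∃ m, f m = x) : Function.Exact f g := by
  have mem_range : ∀ (n : ℕ) (x : N), r ^ n • x = 0 → g x = 0 → ∃ m, f m = x := by
    intro n
    induction n with
    | zero => exact fun x hx _ => ⟨0, by rw [map_zero, ← hx, pow_zero, one_smul]⟩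
    | succ n ih =>
      intro x hx hgx
      obtain ⟨m, hm⟩ := hex (r ^ n • x) (by rw [← mul_smul, ← pow_succ', hx])
        (by rw [map_smul, hgx, smul_zero])
      obtain ⟨m', rfl⟩ : ∃ m', r ^ n • m' = m := by
        simpa only [smul_iterate] using hM.iterate n m
      obtain ⟨m'', hm''⟩ := ih (x - f m') (by rw [smul_sub, ← map_smul, hm, sub_self])
        (by rw [map_sub, hgx, hgf, sub_zero])
      exact ⟨m' + m'', by rw [map_add, hm'', add_sub_cancel]⟩
  intro x
  constructor
  · intro hgx
    obtain ⟨n, hn⟩ := hN x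
    exact mem_range n x hn hgx
  · rintro ⟨m, rfl⟩
    exact hgf m

end PowTorsion

section Sums

variable {M : Type*} [AddCommGroup M]

theorem finsum_eq_zero_of_involutive_of_neg {α : Type*} {f : α → M}
    (hf : (Function.support f).Finite) {σ : α → α} (hσ : Function.Involutive σ)
    (hne : ∀ a, σ a ≠ a) (hneg : ∀ a, f (σ a) = -f a) : ∑ᶠ a, f a = 0 := by
  rw [finsum_eq_sum f hf]
  refine Finset.sum_involution (fun a _ => σ a) (fun a _ => ?_) (fun a _ _ => hne a)
    (fun a ha => ?_) fun a _ => hσ a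
  · rw [hneg, add_neg_cancel]
  · rw [Set.Finite.mem_toFinset, Function.mem_support] at ha ⊢
    rwa [hneg, neg_ne_zero]

theorem eq_zero_of_forall_add_succ_eq_zero {f : ℕ → M} (hf : (Function.support f).Finite)
    (h : ∀ n, f n + f (n + 1) = 0) (n : ℕ) : f n = 0 := by
  by_contra hn
  have hne : ∀ m, n ≤ m → f m ≠ 0 := fun m hm => by
    induction m, hm using Nat.le_induction with
    | base => exact hn
    | succ m _ ih => exact fun h0 => ih (by rw [← h m, h0, add_zero])
  exact (Set.Ici_infinite n).mono hne hf

theorem eq_zero_of_forall_le_add_succ_eq_zero {f : ℤ → M} (hf : (Function.support f).Finite) {N : ℤ}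
    (h : ∀ d, N ≤ d → f d + f (d + 1) = 0) {d : ℤ} (hd : N ≤ d) : f d = 0 := by
  have hfin : (Function.support fun n : ℕ => f (d + n)).Finite :=
    hf.preimage (f := fun n : ℕ => d + n) fun _ _ _ _ h => by simpa using h
  simpa using eq_zero_of_forall_add_succ_eq_zero hfin (fun n => by
    rw [Nat.cast_succ, ← add_assoc]
    exact h _ (by omega)) 0

theorem eq_zero_of_forall_le_add_pred_eq_zero {f : ℤ → M} (hf : (Function.support f).Finite) {N : ℤ}
    (h : ∀ d ≤ N, f d + f (d - 1) = 0) {d : ℤ} (hd : d ≤ N) : f d = 0 := by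
  have hfin : (Function.support fun d => f (-d)).Finite := hf.preimage neg_injective.injOn
  rw [← neg_neg d]
  exact eq_zero_of_forall_le_add_succ_eq_zero hfin (fun d hd => by
    rw [neg_add']
    exact h (-d) (by omega)) (neg_le_neg hd)

end Sums

theorem injective_homologyMap_zero {R : Type*} [Ring R] {K L : CochainComplex (ModuleCat R) ℕ}
    (f : K ⟶ L) [Mono (f.f 0)] :
    Function.Injective (HomologicalComplex.homologyMap f 0).hom :=
  (ModuleCat.mono_iff_injective _).1
    (HomologicalComplex.mono_homologyMap_of_mono_of_not_rel f 0 (by simp))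

theorem max_mul_add_one_eq_max_iff (n m : ℤ) :
    max (n * (n + 1)) (2 * m + (n - 1) * n) = max 0 (2 * m) ↔
      n = 0 ∨ (m < 0 ∧ n = -1) ∨ (0 < m ∧ n = 1) := by
  have nonneg (a : ℤ) : 0 ≤ a * (a + 1) := by
    rcases le_or_gt 0 a with ha | ha <;> nlinarith
  have eq_zero_iff (a : ℤ) : a * (a + 1) = 0 ↔ a = 0 ∨ a = -1 := by
    rw [mul_eq_zero, add_eq_zero_iff_eq_neg]
  have h₁ := nonneg n
  have h₂ := nonneg (n - 1)
  have h₃ := eq_zero_iff n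
  have h₄ := eq_zero_iff (n - 1)
  rw [sub_add_cancel] at h₂ h₄
  have h₅ : (n - 1) * n = n * (n + 1) - 2 * n := by ring
  generalize (n - 1) * n = y at *
  generalize n * (n + 1) = x at *
  omega

namespace PlumbingGraph

universe u

section Tower

theorem tower_X_smul_surjective : Function.Surjective fun t : Tower => (X : ℤ[X]) • t := by
  intro t
  obtain ⟨f, rfl⟩ := Submodule.Quotient.mk_surjective _ t
  refine ⟨Submodule.Quotient.mk (LaurentPolynomial.T (-1) * f), ?_⟩
  dsimp only
  rw [← Submodule.Quotient.mk_smul]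
  congr 1
  change Polynomial.toLaurent _ * _ = _
  rw [Polynomial.toLaurent_X, ← mul_assoc, ← LaurentPolynomial.T_add, add_neg_cancel,
    LaurentPolynomial.T_zero, one_mul]

theorem Upow_smul_eq_ite {x : ℚ} (hx : 0 ≤ x) (hx' : ∃ n : ℤ, x = n) {t : Tower}
    (ht : (X : ℤ[X]) • t = 0) : Upow x • t = if x = 0 then t else 0 := by
  obtain ⟨n, rfl⟩ := hx'
  lift n to ℕ using (by exact_mod_cast hx)
  rw [Upow, Int.cast_natCast, Nat.floor_natCast]
  cases n with
  | zero => rw [pow_zero, one_smul, Nat.cast_zero, if_pos rfl]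
  | succ n => rw [pow_succ, mul_smul, ht, smul_zero, if_neg (Nat.cast_ne_zero.2 n.succ_ne_zero)]

end Tower

section Cochain

variable {J : Type u} [Fintype J] [LinearOrder J] {Γ : PlumbingGraph J} {q : ℕ}

theorem exists_X_pow_smul_eq_zero (φ : Γ.Cochain q) : ∃ n : ℕ, (X ^ n : ℤ[X]) • φ = 0 := by
  choose N hN using tower_torsion
  refine ⟨φ.support.sup fun c => N (φ c), Finsupp.ext fun c => ?_⟩
  rw [Finsupp.smul_apply, Finsupp.zero_apply]
  by_cases hc : φ c = 0
  · rw [hc, smul_zero]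
  · exact hN _ _ (Finset.le_sup (f := fun c => N (φ c)) (Finsupp.mem_support_iff.2 hc))

theorem cochain_X_smul_surjective : Function.Surjective fun φ : Γ.Cochain q => (X : ℤ[X]) • φ := by
  intro φ
  induction φ using Finsupp.induction_linear with
  | zero => exact ⟨0, smul_zero _⟩
  | add φ ψ hφ hψ =>
    obtain ⟨φ', rfl⟩ := hφ
    obtain ⟨ψ', rfl⟩ := hψ
    exact ⟨φ' + ψ', smul_add _ _ _⟩
  | single c t =>
    obtain ⟨t', rfl⟩ := tower_X_smul_surjective t
    exact ⟨Finsupp.single c t', Finsupp.smul_single _ _ _⟩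

theorem ev_zero (K : Γ.Char) (I : Finset J) : ev (0 : Γ.Cochain q) K I = 0 := by
  unfold ev
  split_ifs <;> rfl

theorem ev_of_card_ne (φ : Γ.Cochain q) (K : Γ.Char) {I : Finset J} (hI : I.card ≠ q) :
    ev φ K I = 0 := dif_neg hI

theorem ev_single (c : Γ.Cube q) (t : Tower) (K : Γ.Char) (I : Finset J) :
    ev (Finsupp.single c t) K I = if c.1 = (K, I) then t else 0 := by
  by_cases hI : I.card = q
  · rw [ev, dif_pos hI, Finsupp.single_apply]
    simp only [Subtype.ext_iff]
  · rw [ev_of_card_ne _ _ hI, if_neg fun h => hI (by rw [← c.2, h])]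

theorem X_smul_ev {φ : Γ.Cochain q} (hφ : (X : ℤ[X]) • φ = 0) (K : Γ.Char) (I : Finset J) :
    (X : ℤ[X]) • ev φ K I = 0 := by
  rw [← ev_smul, hφ, ev_zero]

end Cochain

section Line

variable {J V : Type u} [Fintype J] [LinearOrder J] [Fintype V] [LinearOrder V]
  {Γ : PlumbingGraph J} {Δ : PlumbingGraph V} {v : V} {ι : J ↪o V} {q : ℕ}

/-- The parametrization `d ↦ e + 2d` of the integers congruent to `e` modulo `2`. -/
def parityEquiv (e : ℤ) : ℤ ≃ {a : ℤ // a ≡ e [ZMOD 2]} where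
  toFun d := ⟨e + 2 * d, by rw [Int.ModEq]; omega⟩
  invFun a := (a - e) / 2
  left_inv d := by simp
  right_inv a := by
    have := a.2.symm.dvd
    ext
    dsimp only
    omega

/-- The characteristic elements of `Δ` that restrict to `k` on `Γ = Δ ∖ v` form a line, with points
`b(k) + (e_v + 2d) E_v^*`, `d ∈ ℤ`. -/
def line (h : IsVertexDeletion Γ Δ v ι) (hΔ : Δ.Nondegenerate) (k : Γ.Char) (d : ℤ) : Δ.Char :=
  lift h hΔ k (parityEquiv (Δ.e v) d)

theorem pairing_line_ι (h : IsVertexDeletion Γ Δ v ι) (hΔ : Δ.Nondegenerate) (k : Γ.Char) (d : ℤ)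
    (j : J) : Δ.pairing (line h hΔ k d) (E (ι j)) = Γ.pairing k (E j) :=
  pairing_lift_ι h hΔ _ _ _

theorem pairing_line_v (h : IsVertexDeletion Γ Δ v ι) (hΔ : Δ.Nondegenerate) (k : Γ.Char)
    (d : ℤ) : Δ.pairing (line h hΔ k d) (E v) = -(Δ.e v + 2 * d) :=
  (pairing_lift_v h hΔ _ _).trans (by rw [parityEquiv, Equiv.coe_fn_mk]; push_cast; rfl)

theorem line_inj (h : IsVertexDeletion Γ Δ v ι) (hΔ : Δ.Nondegenerate) (hΓ : Γ.Nondegenerate)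
    {k k' : Γ.Char} {d d' : ℤ} : line h hΔ k d = line h hΔ k' d' ↔ k = k' ∧ d = d' := by
  have := (lift_injective h hΔ hΓ).eq_iff (a := (k, parityEquiv (Δ.e v) d))
    (b := (k', parityEquiv (Δ.e v) d'))
  rwa [Prod.mk.injEq, EmbeddingLike.apply_eq_iff_eq] at this

theorem pairing_resMap (hΓ : Γ.Nondegenerate) (x : V → ℚ) (j : J) :
    Γ.pairing (resMap Γ Δ ι x) (E j) = Δ.pairing x (E (ι j)) := by
  simp only [resMap, map_sum, map_smul, LinearMap.sum_apply, LinearMap.smul_apply,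
    hΓ.pairing_Edual, smul_eq_mul]
  rw [Finset.sum_eq_single j] <;> simp +contextual [eq_comm]

theorem exists_line (h : IsVertexDeletion Γ Δ v ι) (hΔ : Δ.Nondegenerate) (hΓ : Γ.Nondegenerate)
    (K : Δ.Char) : ∃ k d, line h hΔ k d = K := by
  have hK := (mem_Char_iff _ _).1 K.2
  have hres : resMap Γ Δ ι K ∈ Γ.Char := (mem_Char_iff _ _).2 fun j => by
    rw [pairing_resMap hΓ, h.e_eq]
    exact hK _
  obtain ⟨n, hn⟩ := hK v
  refine ⟨⟨_, hres⟩, -Δ.e v - n, Subtype.ext (hΔ.ext fun x => ?_)⟩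
  rcases h.cases x with rfl | ⟨j, rfl⟩
  · rw [pairing_line_v, hn]
    push_cast; ring
  · rw [pairing_line_ι, pairing_resMap hΓ]

theorem ext_ev_line (h : IsVertexDeletion Γ Δ v ι) (hΔ : Δ.Nondegenerate) (hΓ : Γ.Nondegenerate)
    {φ ψ : Δ.Cochain q} (hφψ : ∀ k d I, ev φ (line h hΔ k d) I = ev ψ (line h hΔ k d) I) :
    φ = ψ := by
  ext c
  obtain ⟨k, d, hkd⟩ := exists_line h hΔ hΓ c.1.1
  rw [ev_of_card, ev_of_card, ← hkd, hφψ]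

theorem ev_line_finite (h : IsVertexDeletion Γ Δ v ι) (hΔ : Δ.Nondegenerate)
    (hΓ : Γ.Nondegenerate) (φ : Δ.Cochain q) (k : Γ.Char) (I : Finset V) :
    (Function.support fun d => ev φ (line h hΔ k d) I).Finite := by
  have hinj : Function.Injective fun d => (line h hΔ k d, I) := fun d d' hdd' =>
    ((line_inj h hΔ hΓ).1 (congrArg Prod.fst hdd')).2
  exact (ev_finite φ).preimage hinj.injOn

theorem ev_single_line (h : IsVertexDeletion Γ Δ v ι) (hΔ : Δ.Nondegenerate)
    (hΓ : Γ.Nondegenerate) (k k' : Γ.Char) (d d' : ℤ) {I : Finset V} (hI : I.card = q)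
    (I' : Finset V) (t : Tower) :
    ev (Finsupp.single ⟨(line h hΔ k d, I), hI⟩ t) (line h hΔ k' d') I' =
      if (k = k' ∧ d = d') ∧ I = I' then t else 0 := by
  simp only [ev_single, Prod.mk.injEq, line_inj h hΔ hΓ]

theorem ev_bOp (h : IsVertexDeletion Γ Δ v ι) (hΔ : Δ.Nondegenerate) (hΓ : Γ.Nondegenerate)
    (ε : Γ.Char → ℤ → ℤ) (φ : Δ.Cochain q) (k : Γ.Char) (I : Finset J) :
    ev (bOp h hΔ hΓ ε q φ) k I =
      ∑ᶠ d : ℤ, ε k (Δ.e v + 2 * d) • ev φ (line h hΔ k d) (I.map ι.toEmbedding) := by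
  by_cases hI : I.card = q
  · rw [ev, dif_pos hI]
    exact (finsum_comp_equiv (parityEquiv (Δ.e v))).symm
  · rw [ev_of_card_ne _ _ hI]
    refine (finsum_eq_zero_of_forall_eq_zero fun d => ?_).symm
    rw [ev_of_card_ne _ _ (by rwa [Finset.card_map]), smul_zero]

end Line

section Bbar

variable {J V : Type u} [Fintype J] [LinearOrder J] [Fintype V] [LinearOrder V]
  {Γ : PlumbingGraph J} {Δ : PlumbingGraph V} {v : V} {ι : J ↪o V} {q : ℕ}

theorem Bsign_add_two_mul (r : Γ.OrbitRep) (k : Γ.Char) (a d : ℤ) :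
    Bsign Γ Δ v ι r k (a + 2 * d) = d.negOnePow * Bsign Γ Δ v ι r k a := by
  have hn : nVal Γ Δ v ι r k (a + 2 * d) / 2 = nVal Γ Δ v ι r k a / 2 + d := by
    simp only [nVal]
    push_cast; ring
  rw [Bsign, Bsign, hn, Int.floor_add_intCast, add_comm, Int.negOnePow_add, Units.val_mul]

theorem Bsign_mul_self (r : Γ.OrbitRep) (k : Γ.Char) (a : ℤ) :
    Bsign Γ Δ v ι r k a * Bsign Γ Δ v ι r k a = 1 := by
  rw [Bsign, ← Units.val_mul, Int.units_mul_self, Units.val_one]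

/-- The component `B̄^q : ℱ^q(Δ) → ℱ^q(Γ)` of the morphism of complexes `B̄^*`, `Γ = Δ ∖ v`. -/
abbrev bbarOp (h : IsVertexDeletion Γ Δ v ι) (hΔ : Δ.Nondegenerate) (hΓ : Γ.Nondegenerate)
    (r : Γ.OrbitRep) (q : ℕ) : Δ.Cochain q →ₗ[ℤ[X]] Γ.Cochain q :=
  bOp h hΔ hΓ (Bsign Γ Δ v ι r) q

theorem ev_bbarOp (h : IsVertexDeletion Γ Δ v ι) (hΔ : Δ.Nondegenerate) (hΓ : Γ.Nondegenerate)
    (r : Γ.OrbitRep) (φ : Δ.Cochain q) (k : Γ.Char) (I : Finset J) :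
    ev (bbarOp h hΔ hΓ r q φ) k I = ∑ᶠ d : ℤ,
      (d.negOnePow * Bsign Γ Δ v ι r k (Δ.e v) : ℤ) •
        ev φ (line h hΔ k d) (I.map ι.toEmbedding) := by
  simp only [ev_bOp, Bsign_add_two_mul]

/-- The section of `B̄^q` with values in the cochains supported on the cubes `(k, I)` of `Δ` for
which `v ∉ I` and `k` is the point `0` of its line. -/
def bbarSection (h : IsVertexDeletion Γ Δ v ι) (hΔ : Δ.Nondegenerate) (r : Γ.OrbitRep) (q : ℕ) :
    Γ.Cochain q →ₗ[ℤ[X]] Δ.Cochain q :=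
  Finsupp.lsum ℤ[X] fun c => Bsign Γ Δ v ι r c.1.1 (Δ.e v) • Finsupp.lsingle
    ⟨(line h hΔ c.1.1 0, c.1.2.map ι.toEmbedding), (Finset.card_map _).trans c.2⟩

theorem bbarSection_single (h : IsVertexDeletion Γ Δ v ι) (hΔ : Δ.Nondegenerate) (r : Γ.OrbitRep)
    (k : Γ.Char) {I : Finset J} (hI : I.card = q) (t : Tower) :
    bbarSection h hΔ r q (Finsupp.single ⟨(k, I), hI⟩ t) = Finsupp.single
      ⟨(line h hΔ k 0, I.map ι.toEmbedding), (Finset.card_map _).trans hI⟩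
      (Bsign Γ Δ v ι r k (Δ.e v) • t) := by
  rw [bbarSection, Finsupp.lsum_single, LinearMap.smul_apply, Finsupp.lsingle_apply,
    Finsupp.smul_single]

theorem bbarOp_single_line_zero (h : IsVertexDeletion Γ Δ v ι) (hΔ : Δ.Nondegenerate)
    (hΓ : Γ.Nondegenerate) (r : Γ.OrbitRep) (k : Γ.Char) {I : Finset J} (hI : I.card = q)
    (t : Tower) :
    bbarOp h hΔ hΓ r q (Finsupp.single
      ⟨(line h hΔ k 0, I.map ι.toEmbedding), (Finset.card_map _).trans hI⟩ t) =
      Finsupp.single ⟨(k, I), hI⟩ (Bsign Γ Δ v ι r k (Δ.e v) • t) := by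
  ext c
  rw [ev_of_card, ev_of_card, ev_bbarOp, finsum_eq_single _ (0 : ℤ)]
  · simp only [ev_single_line h hΔ hΓ, ev_single, and_true, Finset.map_inj, Prod.mk.injEq,
      Int.negOnePow_zero, Units.val_one, one_mul]
    split_ifs with hc
    · rw [hc.1]
    · exact smul_zero _
  · intro d hd
    rw [ev_single_line h hΔ hΓ, if_neg fun hc => hd hc.1.2.symm, smul_zero]

theorem bbarOp_bbarSection (h : IsVertexDeletion Γ Δ v ι) (hΔ : Δ.Nondegenerate)
    (hΓ : Γ.Nondegenerate) (r : Γ.OrbitRep) (χ : Γ.Cochain q) :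
    bbarOp h hΔ hΓ r q (bbarSection h hΔ r q χ) = χ := by
  induction χ using Finsupp.induction_linear with
  | zero => rw [map_zero, map_zero]
  | add χ χ' hχ hχ' => rw [map_add, map_add, hχ, hχ']
  | single c t =>
    rw [bbarSection_single, bbarOp_single_line_zero, ← mul_smul, Bsign_mul_self, one_smul]

end Bbar

theorem exists_map_eq_of_notMem {J V : Type u} [LinearOrder J] [LinearOrder V]
    {Γ : PlumbingGraph J} {Δ : PlumbingGraph V} {v : V} {ι : J ↪o V}
    (h : IsVertexDeletion Γ Δ v ι) {I : Finset V} (hI : v ∉ I) :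
    ∃ I₀ : Finset J, I₀.map ι.toEmbedding = I := by
  have hrange : (I : Set V) ⊆ ι '' Set.univ := by
    rwa [Set.image_univ, h.range_eq, Set.subset_compl_singleton_iff, Finset.mem_coe]
  obtain ⟨I₀, -, hI₀⟩ := Finset.subset_set_image_iff.1 hrange
  exact ⟨I₀, (Finset.map_eq_image _ _).trans hI₀⟩

section Weights

variable {J V : Type u} [Fintype J] [LinearOrder J] [Fintype V] [LinearOrder V]
  {Γ : PlumbingGraph J} {Δ : PlumbingGraph V} {v : V} {ι : J ↪o V}

theorem weight_le_cubeWeight (Γ : PlumbingGraph J) (k : J → ℚ) {I I' : Finset J} (h : I' ⊆ I) :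
    Γ.weight (k + (2 : ℚ) • EI I') ≤ Γ.cubeWeight k I :=
  Finset.le_sup' (fun I' => Γ.weight (k + (2 : ℚ) • EI I')) (Finset.mem_powerset.2 h)

theorem cubeWeight_eq_max (Γ : PlumbingGraph J) (k : J → ℚ) {I : Finset J} {j : J} (hj : j ∈ I) :
    Γ.cubeWeight k I =
      max (Γ.cubeWeight k (I.erase j)) (Γ.cubeWeight (k + (2 : ℚ) • E j) (I.erase j)) := by
  refine le_antisymm (Finset.sup'_le _ _ fun I' hI' => ?_)
    (max_le (Γ.cubeWeight_erase_le k I j) (Γ.cubeWeight_shift_erase_le k hj))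
  have hsub := Finset.erase_subset_erase j (Finset.mem_powerset.1 hI')
  by_cases hjI' : j ∈ I'
  · have hEI : EI I' = E j + EI (I'.erase j) := (Finset.add_sum_erase I' E hjI').symm
    rw [hEI, smul_add, ← add_assoc]
    exact le_max_of_le_right (Γ.weight_le_cubeWeight _ hsub)
  · rw [Finset.erase_eq_of_notMem hjI'] at hsub
    exact le_max_of_le_left (Γ.weight_le_cubeWeight k hsub)

theorem cubeWeight_blowUp {Γ' : PlumbingGraph (WithTop J)} {j₀ : J} (h : Γ' = Γ.blowUp j₀)
    (K : WithTop J → ℚ) {I : Finset J} (hI : j₀ ∉ I) :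
    Γ'.cubeWeight K (up I) = Γ.cubeWeight (piStar K) I + ((K ⊤ - K j₀) ^ 2 - 1) / 8 := by
  have weight_vertex : ∀ I' ⊆ I, Γ'.weight (K + (2 : ℚ) • EI (up I')) =
      Γ.weight (piStar K + (2 : ℚ) • EI I') + ((K ⊤ - K j₀) ^ 2 - 1) / 8 := fun I' hI' => by
    rw [weight_piStar h, piStar_vertex, odd_vertex, if_neg fun hj => hI (hI' hj), sub_zero]
  apply le_antisymm
  · refine Finset.sup'_le _ _ fun I' hI' => ?_
    obtain ⟨I₀, hI₀, rfl⟩ := Finset.subset_map_iff.1 (Finset.mem_powerset.1 hI')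
    rw [weight_vertex I₀ hI₀]
    gcongr
    exact Γ.weight_le_cubeWeight _ hI₀
  · rw [← le_sub_iff_add_le]
    refine Finset.sup'_le _ _ fun I' hI' => ?_
    rw [Finset.mem_powerset] at hI'
    rw [le_sub_iff_add_le, ← weight_vertex I' hI']
    exact Γ'.weight_le_cubeWeight _ (Finset.map_subset_map.2 hI')

theorem cubeWeight_blowUp_of_mem {Γ' : PlumbingGraph (WithTop J)} {j₀ : J}
    (h : Γ' = Γ.blowUp j₀) (K : WithTop J → ℚ) {I : Finset J} (hI : j₀ ∈ I) :
    Γ'.cubeWeight K (up I) =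
      max (Γ.cubeWeight (piStar K) (I.erase j₀) + ((K ⊤ - K j₀) ^ 2 - 1) / 8)
        (Γ.cubeWeight (piStar K + (2 : ℚ) • E j₀) (I.erase j₀) +
          ((K ⊤ - K j₀ - 2) ^ 2 - 1) / 8) := by
  have hmem : (j₀ : WithTop J) ∈ up I := Finset.mem_map_of_mem _ hI
  have herase : (up I).erase (j₀ : WithTop J) = up (I.erase j₀) :=
    (Finset.map_erase WithTop.coeOrderHom.toEmbedding I j₀).symm
  have hpi : piStar (K + (2 : ℚ) • E (j₀ : WithTop J)) = piStar K + (2 : ℚ) • E j₀ := by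
    rw [← piStar_E_coe j₀]
    rfl
  have htop : (K + (2 : ℚ) • E (j₀ : WithTop J)) ⊤ - (K + (2 : ℚ) • E (j₀ : WithTop J)) j₀ =
      K ⊤ - K j₀ - 2 := by
    simp [E, sub_sub]
  have hj₀ := Finset.notMem_erase j₀ I
  rw [cubeWeight_eq_max _ _ hmem, herase,
    cubeWeight_blowUp h _ hj₀, cubeWeight_blowUp h _ hj₀, hpi, htop]

theorem cubeWeight_sub_weight_congr (h : IsVertexDeletion Γ Δ v ι) (hΓ : Γ.Nondegenerate)
    {K K' : V → ℚ} (hK : ∀ j, Δ.pairing K (E (ι j)) = Δ.pairing K' (E (ι j))) {I : Finset V}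
    (hI : v ∉ I) : Δ.cubeWeight K I - Δ.weight K = Δ.cubeWeight K' I - Δ.weight K' := by
  obtain ⟨I, rfl⟩ := exists_map_eq_of_notMem h hI
  rw [cubeWeight_map h (k := resMap Γ Δ ι K') fun j => (hK j).trans (pairing_resMap hΓ _ _).symm,
    cubeWeight_map h (k := resMap Γ Δ ι K') fun j => (pairing_resMap hΓ _ _).symm]
  ring

theorem weight_line_add_two_smul_E (h : IsVertexDeletion Γ Δ v ι) (hΔ : Δ.Nondegenerate)
    (k : Γ.Char) (s : ℤ) : Δ.weight ((line h hΔ k s : V → ℚ) + (2 : ℚ) • E v) =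
      Δ.weight (line h hΔ k s) + s := by
  rw [weight_add, chi, map_add, LinearMap.add_apply, pairing_line_v, pairing_E_E, form_self]
  ring

theorem exists_cubeWeight_line_add_two_smul_E (h : IsVertexDeletion Γ Δ v ι)
    (hΔ : Δ.Nondegenerate) (hΓ : Γ.Nondegenerate) (k : Γ.Char) {I : Finset V} (hI : v ∉ I) :
    ∃ C : ℤ, ∀ s : ℤ, Δ.cubeWeight ((line h hΔ k s : V → ℚ) + (2 : ℚ) • E v) I =
      Δ.cubeWeight (line h hΔ k s) I + (s - C) := by
  obtain ⟨C, hC⟩ : ∃ C : ℤ, Δ.cubeWeight (line h hΔ k 0) I -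
      Δ.cubeWeight ((line h hΔ k 0 : V → ℚ) + (2 : ℚ) • E v) I = C := exp_shift_int _ v I I
  refine ⟨C, fun s => ?_⟩
  have h₀ := cubeWeight_sub_weight_congr h hΓ (K := line h hΔ k s) (K' := line h hΔ k 0)
    (fun j => by rw [pairing_line_ι, pairing_line_ι]) hI
  have h₁ := cubeWeight_sub_weight_congr h hΓ (K := (line h hΔ k s : V → ℚ) + (2 : ℚ) • E v)
    (K' := (line h hΔ k 0 : V → ℚ) + (2 : ℚ) • E v)
    (fun j => by simp only [map_add, LinearMap.add_apply, pairing_line_ι]) hI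
  rw [weight_line_add_two_smul_E, weight_line_add_two_smul_E, Int.cast_zero] at h₁
  linarith

end Weights

theorem plus_isVertexDeletion {J : Type u} [LinearOrder J] (Γ : PlumbingGraph J) (j₀ : J) :
    IsVertexDeletion (Γ.delete j₀) (Γ.plus j₀) j₀ (OrderEmbedding.subtype (· ≠ j₀)) where
  range_eq := by ext; simp
  graph_eq := rfl
  e_eq j := by simp [plus, addDecoration, delete, j.2]

theorem plus_e {J : Type u} [LinearOrder J] (Γ : PlumbingGraph J) (j₀ : J) :
    (Γ.plus j₀).e j₀ = Γ.e j₀ + 1 := by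
  simp [plus, addDecoration]

section Amap

variable {J : Type u} [Fintype J] [LinearOrder J] {Γ : PlumbingGraph J} {j₀ : J} {q : ℕ}

theorem attach_pairing_E_top (Γ : PlumbingGraph J) (j₀ : J) (x : WithTop J → ℚ) :
    (Γ.attach j₀).pairing x (E ⊤) = x j₀ - x ⊤ := by
  rw [attach_pairing, piStar_E_top, map_zero]
  simp [E]

theorem pairing_piStar_E (Γ : PlumbingGraph J) (j₀ : J) (x : WithTop J → ℚ) (j : J) :
    (Γ.plus j₀).pairing (piStar x) (E j) =
      (Γ.attach j₀).pairing x (E (j : WithTop J)) - (x ⊤ - x j₀) * (if j = j₀ then 1 else 0) := by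
  rw [blowUp_plus, blowUp_pairing, piStar_E_coe]
  simp only [E, Pi.single_apply, WithTop.top_ne_coe, WithTop.coe_inj, eq_comm (a := j₀), if_false]
  ring

/-- The line of characteristic elements of `Γ` over `k ∈ Char(Γ ∖ j₀)`. -/
abbrev deleteLine (hΓ : Γ.Nondegenerate) (k : (Γ.delete j₀).Char) (d : ℤ) : Γ.Char :=
  line (Γ.delete_isVertexDeletion j₀) hΓ k d

/-- The line of characteristic elements of `Γ_{j₀}^+` over `k`; recall `Γ_{j₀}^+ ∖ j₀ = Γ ∖ j₀`. -/
abbrev plusLine (hplus : (Γ.plus j₀).Nondegenerate) (k : (Γ.delete j₀).Char) (s : ℤ) :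
    (Γ.plus j₀).Char :=
  line (Γ.plus_isVertexDeletion j₀) hplus k s

/-- The plane of characteristic elements of `Γ^b` over `k`. The coordinate `d` is the restriction to
`Γ`, and the shift by `d - 1` in the other direction makes `s` the coordinate of the image
under `π_*`. -/
def blowUpPlane (hplus : (Γ.plus j₀).Nondegenerate) (hΓ : Γ.Nondegenerate)
    (k : (Γ.delete j₀).Char) (d s : ℤ) : (Γ.attach j₀).Char :=
  line (Γ.attach_isVertexDeletion j₀) (attach_nondegenerate hplus) (deleteLine hΓ k d) (s - (d - 1))

theorem blowUpPlane_top_sub (hplus : (Γ.plus j₀).Nondegenerate) (hΓ : Γ.Nondegenerate)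
    (k : (Γ.delete j₀).Char) (d s : ℤ) :
    (blowUpPlane hplus hΓ k d s : WithTop J → ℚ) ⊤ -
      (blowUpPlane hplus hΓ k d s : WithTop J → ℚ) j₀ = 2 * (s - d) + 1 := by
  have hpair := pairing_line_v (Γ.attach_isVertexDeletion j₀) (attach_nondegenerate hplus)
    (deleteLine hΓ k d) (s - (d - 1))
  have he : (Γ.attach j₀).e ⊤ = -1 := rfl
  rw [attach_pairing_E_top, he] at hpair
  rw [blowUpPlane, ← neg_sub, hpair]
  push_cast; ring

theorem piChar_blowUpPlane (hplus : (Γ.plus j₀).Nondegenerate) (hΓ : Γ.Nondegenerate)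
    (k : (Γ.delete j₀).Char) (d s : ℤ) :
    piChar (Γ.blowUp_plus j₀) (blowUpPlane hplus hΓ k d s) = plusLine hplus k s := by
  refine Subtype.ext (hplus.ext fun x => ?_)
  have hrestrict : (Γ.attach j₀).pairing (blowUpPlane hplus hΓ k d s) (E (x : WithTop J)) =
      Γ.pairing (deleteLine hΓ k d) (E x) :=
    pairing_line_ι (Γ.attach_isVertexDeletion j₀) (attach_nondegenerate hplus) _ _ x
  rw [piChar, pairing_piStar_E, blowUpPlane_top_sub, hrestrict]
  rcases (Γ.plus_isVertexDeletion j₀).cases x with rfl | ⟨j, rfl⟩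
  · rw [pairing_line_v, pairing_line_v, plus_e, if_pos rfl]
    push_cast; ring
  · rw [pairing_line_ι, pairing_line_ι, if_neg ((Γ.plus_isVertexDeletion j₀).ne j), mul_zero,
      sub_zero]

theorem piStar_blowUpPlane (hplus : (Γ.plus j₀).Nondegenerate) (hΓ : Γ.Nondegenerate)
    (k : (Γ.delete j₀).Char) (d s : ℤ) :
    piStar (blowUpPlane hplus hΓ k d s : WithTop J → ℚ) = plusLine hplus k s :=
  congrArg Subtype.val (piChar_blowUpPlane hplus hΓ k d s)

/-- The component `A^q : ℱ^q(Γ_{j₀}^+) → ℱ^q(Γ)` of the morphism of complexes `A^*`. -/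
def aOp (hplus : (Γ.plus j₀).Nondegenerate) (hΓ : Γ.Nondegenerate) (q : ℕ) :
    (Γ.plus j₀).Cochain q →ₗ[ℤ[X]] Γ.Cochain q :=
  bOp (Γ.attach_isVertexDeletion j₀) (attach_nondegenerate hplus) hΓ (fun _ _ => 1) q ∘ₗ
    piOp (Γ.blowUp_plus j₀) q

/-- The exponent of `U` at `φ(s, I)` in the value of `A φ` at `(d, I)`, where `d` and `s` stand for
the points of the lines in `Char(Γ)` and `Char(Γ_{j₀}^+)` over `k`. -/
def lineExp (hplus : (Γ.plus j₀).Nondegenerate) (hΓ : Γ.Nondegenerate) (k : (Γ.delete j₀).Char)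
    (I : Finset J) (d s : ℤ) : ℚ :=
  (Γ.attach j₀).cubeWeight (blowUpPlane hplus hΓ k d s) (up I) -
    (Γ.plus j₀).cubeWeight (plusLine hplus k s) I

theorem ev_piOp_up {Γ' : PlumbingGraph (WithTop J)} (h : Γ' = Γ.blowUp j₀) (φ : Γ.Cochain q)
    (K : Γ'.Char) (I : Finset J) : ev (piOp h q φ) K (up I) =
      Upow (Γ'.cubeWeight K (up I) - Γ.cubeWeight (piChar h K) I) • ev φ (piChar h K) I := by
  by_cases hI : I.card = q
  · rw [ev, dif_pos (by rwa [up, Finset.card_map])]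
    change piVal h φ K (up I) = _
    rw [piVal, if_neg (top_notMem_up I), down_up]
  · rw [ev_of_card_ne _ _ hI, smul_zero, ev_of_card_ne _ _ (by rwa [up, Finset.card_map])]

theorem ev_aOp (hplus : (Γ.plus j₀).Nondegenerate) (hΓ : Γ.Nondegenerate)
    (φ : (Γ.plus j₀).Cochain q) (k : (Γ.delete j₀).Char) (d : ℤ) (I : Finset J) :
    ev (aOp hplus hΓ q φ) (deleteLine hΓ k d) I =
      ∑ᶠ s : ℤ, Upow (lineExp hplus hΓ k I d s) • ev φ (plusLine hplus k s) I := by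
  rw [aOp, LinearMap.comp_apply, ev_bOp, ← finsum_comp_equiv (Equiv.subRight (d - 1))]
  refine finsum_congr fun s => ?_
  rw [one_smul, lineExp, ← piChar_blowUpPlane hplus hΓ k d s]
  exact ev_piOp_up _ φ (blowUpPlane hplus hΓ k d s) I

theorem Upow_lineExp_smul (hplus : (Γ.plus j₀).Nondegenerate) (hΓ : Γ.Nondegenerate)
    (k : (Γ.delete j₀).Char) (I : Finset J) (d s : ℤ) {t : Tower} (ht : (X : ℤ[X]) • t = 0) :
    Upow (lineExp hplus hΓ k I d s) • t = if lineExp hplus hΓ k I d s = 0 then t else 0 := by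
  rw [lineExp, ← piChar_blowUpPlane hplus hΓ k d s]
  exact Upow_smul_eq_ite (pi_exp_nonneg _ _ _) (pi_exp_int _ _ _ _) ht

theorem lineExp_of_notMem (hplus : (Γ.plus j₀).Nondegenerate) (hΓ : Γ.Nondegenerate)
    (k : (Γ.delete j₀).Char) {I : Finset J} (hI : j₀ ∉ I) (d s : ℤ) :
    lineExp hplus hΓ k I d s = ((s - d) * (s - d + 1) : ℚ) / 2 := by
  rw [lineExp, cubeWeight_blowUp (Γ.blowUp_plus j₀) _ hI, piStar_blowUpPlane, blowUpPlane_top_sub]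
  ring

theorem lineExp_eq_zero_iff_of_notMem (hplus : (Γ.plus j₀).Nondegenerate) (hΓ : Γ.Nondegenerate)
    (k : (Γ.delete j₀).Char) {I : Finset J} (hI : j₀ ∉ I) (d s : ℤ) :
    lineExp hplus hΓ k I d s = 0 ↔ s = d ∨ s + 1 = d := by
  rw [lineExp_of_notMem hplus hΓ k hI, div_eq_zero_iff, mul_eq_zero, or_iff_left two_ne_zero]
  norm_cast
  omega

theorem exists_lineExp_of_mem (hplus : (Γ.plus j₀).Nondegenerate) (hΓ : Γ.Nondegenerate)
    (hdel : (Γ.delete j₀).Nondegenerate) (k : (Γ.delete j₀).Char) {I : Finset J} (hI : j₀ ∈ I) :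
    ∃ C : ℤ, ∀ d s : ℤ, lineExp hplus hΓ k I d s =
      ((max ((s - d) * (s - d + 1)) (2 * (s - C) + (s - d - 1) * (s - d)) -
        max 0 (2 * (s - C)) : ℤ) : ℚ) / 2 := by
  obtain ⟨C, hC⟩ := exists_cubeWeight_line_add_two_smul_E (Γ.plus_isVertexDeletion j₀) hplus hdel k
    (Finset.notMem_erase j₀ I)
  refine ⟨C, fun d s => ?_⟩
  rw [lineExp, cubeWeight_eq_max _ _ hI, cubeWeight_blowUp_of_mem (Γ.blowUp_plus j₀) _ hI,
    piStar_blowUpPlane, blowUpPlane_top_sub, hC]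
  generalize (Γ.plus j₀).cubeWeight (plusLine hplus k s) (I.erase j₀) = M
  have hblowUp : max (M + ((2 * (s - d) + 1) ^ 2 - 1) / 8)
      (M + (s - C) + ((2 * (s - d) + 1 - 2) ^ 2 - 1) / 8) =
      M + (max ((s - d) * (s - d + 1)) (2 * (s - C) + (s - d - 1) * (s - d)) : ℤ) / 2 := by
    push_cast
    rw [← max_div_div_right (zero_le_two (α := ℚ)), ← max_add_add_left]
    congr 1 <;> ring
  have hplusLine : max M (M + (s - C)) = M + (max 0 (2 * (s - C)) : ℤ) / 2 := by
    push_cast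
    rw [← max_div_div_right (zero_le_two (α := ℚ)), ← max_add_add_left]
    congr 1 <;> ring
  rw [hblowUp, hplusLine]
  push_cast
  ring

theorem exists_lineExp_eq_zero_iff_of_mem (hplus : (Γ.plus j₀).Nondegenerate)
    (hΓ : Γ.Nondegenerate) (hdel : (Γ.delete j₀).Nondegenerate) (k : (Γ.delete j₀).Char)
    {I : Finset J} (hI : j₀ ∈ I) : ∃ C : ℤ, ∀ d s : ℤ,
      lineExp hplus hΓ k I d s = 0 ↔ s = d ∨ (s < C ∧ s + 1 = d) ∨ (C < s ∧ s = d + 1) := by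
  obtain ⟨C, hC⟩ := exists_lineExp_of_mem hplus hΓ hdel k hI
  refine ⟨C, fun d s => ?_⟩
  rw [hC, div_eq_zero_iff, or_iff_left two_ne_zero, Int.cast_eq_zero, sub_eq_zero,
    max_mul_add_one_eq_max_iff]
  omega

end Amap

section Exactness

variable {J : Type u} [Fintype J] [LinearOrder J] {Γ : PlumbingGraph J} {j₀ : J} {q : ℕ}

theorem ev_aOp_of_X_smul_eq_zero (hplus : (Γ.plus j₀).Nondegenerate) (hΓ : Γ.Nondegenerate)
    {φ : (Γ.plus j₀).Cochain q} (hφ : (X : ℤ[X]) • φ = 0) (k : (Γ.delete j₀).Char) (d : ℤ)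
    (I : Finset J) (S : Finset ℤ) (hS : ∀ s, lineExp hplus hΓ k I d s = 0 ↔ s ∈ S) :
    ev (aOp hplus hΓ q φ) (deleteLine hΓ k d) I = ∑ s ∈ S, ev φ (plusLine hplus k s) I := by
  simp only [ev_aOp, Upow_lineExp_smul _ _ _ _ _ _ (X_smul_ev hφ _ _), hS]
  rw [finsum_eq_sum_of_support_subset _ (s := S) fun s hs => by
    by_contra hsS
    exact hs (if_neg hsS)]
  exact Finset.sum_congr rfl fun s hs => if_pos hs

theorem ev_eq_zero_of_aOp_eq_zero_of_notMem (hplus : (Γ.plus j₀).Nondegenerate)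
    (hΓ : Γ.Nondegenerate) (hdel : (Γ.delete j₀).Nondegenerate) {φ : (Γ.plus j₀).Cochain q}
    (hφ : (X : ℤ[X]) • φ = 0) (hAφ : aOp hplus hΓ q φ = 0) (k : (Γ.delete j₀).Char)
    {I : Finset J} (hI : j₀ ∉ I) (s : ℤ) : ev φ (plusLine hplus k s) I = 0 := by
  have relation : ∀ d, ev φ (plusLine hplus k d) I + ev φ (plusLine hplus k (d - 1)) I = 0 :=
    fun d => by
      have := ev_aOp_of_X_smul_eq_zero hplus hΓ hφ k d I {d, d - 1} fun s => by
        rw [lineExp_eq_zero_iff_of_notMem hplus hΓ k hI, Finset.mem_insert, Finset.mem_singleton,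
          eq_sub_iff_add_eq]
      rwa [hAφ, ev_zero, Finset.sum_pair (by omega), eq_comm] at this
  exact eq_zero_of_forall_le_add_pred_eq_zero
    (ev_line_finite (Γ.plus_isVertexDeletion j₀) hplus hdel φ k I) (fun d _ => relation d) le_rfl

theorem ev_eq_zero_of_aOp_eq_zero_of_mem (hplus : (Γ.plus j₀).Nondegenerate)
    (hΓ : Γ.Nondegenerate) (hdel : (Γ.delete j₀).Nondegenerate) {φ : (Γ.plus j₀).Cochain q}
    (hφ : (X : ℤ[X]) • φ = 0) (hAφ : aOp hplus hΓ q φ = 0) (k : (Γ.delete j₀).Char)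
    {I : Finset J} (hI : j₀ ∈ I) (s : ℤ) : ev φ (plusLine hplus k s) I = 0 := by
  obtain ⟨C, hC⟩ := exists_lineExp_eq_zero_iff_of_mem hplus hΓ hdel k hI
  set f : ℤ → Tower := fun s => ev φ (plusLine hplus k s) I
  have relation : ∀ (d : ℤ) (S : Finset ℤ),
      (∀ s, (s = d ∨ (s < C ∧ s + 1 = d) ∨ (C < s ∧ s = d + 1)) ↔ s ∈ S) → ∑ s ∈ S, f s = 0 :=
    fun d S hS => by
      rw [← ev_aOp_of_X_smul_eq_zero hplus hΓ hφ k d I S fun s => (hC d s).trans (hS s), hAφ,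
        ev_zero]
  have hfin := ev_line_finite (Γ.plus_isVertexDeletion j₀) hplus hdel φ k I
  have hlt : ∀ s ≤ C - 1, f s = 0 := fun _ =>
    eq_zero_of_forall_le_add_pred_eq_zero hfin fun d hd => by
      rw [← relation d {d, d - 1} fun s => by
        rw [Finset.mem_insert, Finset.mem_singleton]; omega, Finset.sum_pair (by omega)]
  have hgt : ∀ s, C + 1 ≤ s → f s = 0 := fun _ =>
    eq_zero_of_forall_le_add_succ_eq_zero hfin fun d hd => by
      rw [← relation d {d, d + 1} fun s => by
        rw [Finset.mem_insert, Finset.mem_singleton]; omega, Finset.sum_pair (by omega)]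
  rcases lt_trichotomy s C with hs | rfl | hs
  · exact hlt s (by omega)
  · have hs := relation s {s, s - 1, s + 1} fun s' => by
      simp only [Finset.mem_insert, Finset.mem_singleton]; omega
    rwa [Finset.sum_insert (by rw [Finset.mem_insert, Finset.mem_singleton]; omega),
      Finset.sum_pair (by omega), hlt _ le_rfl, hgt _ le_rfl, add_zero, add_zero] at hs
  · exact hgt s hs

theorem aOp_injective (hplus : (Γ.plus j₀).Nondegenerate) (hΓ : Γ.Nondegenerate)
    (hdel : (Γ.delete j₀).Nondegenerate) : Function.Injective (aOp hplus hΓ q) := by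
  refine injective_of_pow_torsion _ exists_X_pow_smul_eq_zero fun φ hφ hAφ => ?_
  refine ext_ev_line (Γ.plus_isVertexDeletion j₀) hplus hdel fun k s I => ?_
  rw [ev_zero]
  by_cases hI : j₀ ∈ I
  · exact ev_eq_zero_of_aOp_eq_zero_of_mem hplus hΓ hdel hφ hAφ k hI s
  · exact ev_eq_zero_of_aOp_eq_zero_of_notMem hplus hΓ hdel hφ hAφ k hI s

theorem ev_aOp_single (hplus : (Γ.plus j₀).Nondegenerate) (hΓ : Γ.Nondegenerate)
    (hdel : (Γ.delete j₀).Nondegenerate) (k k' : (Γ.delete j₀).Char) (s d : ℤ) {I : Finset J}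
    (hI : I.card = q) (I' : Finset J) (t : Tower) :
    ev (aOp hplus hΓ q (Finsupp.single ⟨(plusLine hplus k s, I), hI⟩ t)) (deleteLine hΓ k' d) I' =
      if k = k' ∧ I = I' then Upow (lineExp hplus hΓ k I d s) • t else 0 := by
  simp only [ev_aOp, ev_single_line (Γ.plus_isVertexDeletion j₀) hplus hdel]
  rw [finsum_eq_single _ s fun s' hs' => by rw [if_neg fun h => hs' h.1.2.symm, smul_zero]]
  simp only [and_true]
  split_ifs with h
  · rw [h.1, h.2]
  · rw [smul_zero]

theorem aOp_single (hplus : (Γ.plus j₀).Nondegenerate) (hΓ : Γ.Nondegenerate)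
    (hdel : (Γ.delete j₀).Nondegenerate) (k : (Γ.delete j₀).Char) (s : ℤ) {I : Finset J}
    (hI : I.card = q) {t : Tower} (ht : (X : ℤ[X]) • t = 0) (S : Finset ℤ)
    (hS : ∀ d, lineExp hplus hΓ k I d s = 0 ↔ d ∈ S) :
    aOp hplus hΓ q (Finsupp.single ⟨(plusLine hplus k s, I), hI⟩ t) =
      ∑ d ∈ S, Finsupp.single ⟨(deleteLine hΓ k d, I), hI⟩ t := by
  ext ⟨⟨K, I'⟩, hI'⟩
  obtain ⟨k', d, rfl⟩ := exists_line (Γ.delete_isVertexDeletion j₀) hΓ hdel K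
  rw [ev_of_card, ev_aOp_single hplus hΓ hdel, Upow_lineExp_smul _ _ _ _ _ _ ht,
    Finsupp.finsetSum_apply]
  simp only [ev_of_card, ev_single_line _ hΓ hdel, hS]
  by_cases h : k = k' ∧ I = I'
  · simp [h.1, h.2]
  · rw [if_neg h, Finset.sum_eq_zero fun d' _ => if_neg fun h' => h ⟨h'.1.1, h'.2⟩]

/-- The exponent of `U` is invariant under the reflection `d ↦ 2s + 1 - d`, while the sign in `B̄`
changes. -/
theorem bbarOp_aOp (hplus : (Γ.plus j₀).Nondegenerate) (hΓ : Γ.Nondegenerate)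
    (hdel : (Γ.delete j₀).Nondegenerate) (r : (Γ.delete j₀).OrbitRep)
    (φ : (Γ.plus j₀).Cochain q) :
    bbarOp (Γ.delete_isVertexDeletion j₀) hΓ hdel r q (aOp hplus hΓ q φ) = 0 := by
  induction φ using Finsupp.induction_linear with
  | zero => rw [map_zero, map_zero]
  | add φ ψ hφ hψ => rw [map_add, map_add, hφ, hψ, add_zero]
  | single c t =>
    obtain ⟨⟨K, I⟩, hI⟩ := c
    obtain ⟨k, s, rfl⟩ := exists_line (Γ.plus_isVertexDeletion j₀) hplus hdel K
    ext ⟨⟨k', I'⟩, hI'⟩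
    have hj₀ : j₀ ∉ I'.map (OrderEmbedding.subtype (· ≠ j₀)).toEmbedding := by simp
    have hsign (d : ℤ) : ((2 * s + 1 - d).negOnePow : ℤ) = -d.negOnePow := by
      rw [Int.negOnePow_sub, Int.negOnePow_succ, Int.negOnePow_even _ (even_two_mul s), neg_mul,
        one_mul, Units.val_neg]
    have hfin := (ev_line_finite (Γ.delete_isVertexDeletion j₀) hΓ hdel (aOp hplus hΓ q
      (Finsupp.single ⟨(plusLine hplus k s, I), hI⟩ t)) k'
      (I'.map (OrderEmbedding.subtype (· ≠ j₀)).toEmbedding)).subset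
      (Function.support_smul_subset_right (fun d : ℤ => (d.negOnePow *
        Bsign (Γ.delete j₀) Γ j₀ (OrderEmbedding.subtype (· ≠ j₀)) r k' (Γ.e j₀) : ℤ)) _)
    rw [ev_of_card, ev_bbarOp, Finsupp.zero_apply]
    refine finsum_eq_zero_of_involutive_of_neg hfin (σ := fun d => 2 * s + 1 - d)
      (fun d => sub_sub_cancel _ d) (fun d => by omega) fun d => ?_
    rw [ev_aOp_single hplus hΓ hdel, ev_aOp_single hplus hΓ hdel, hsign, neg_mul, neg_smul]
    split_ifs with h
    · rw [h.2, lineExp_of_notMem hplus hΓ k hj₀, lineExp_of_notMem hplus hΓ k hj₀]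
      congr 4
      push_cast; ring
    · rfl

theorem single_mem_range_aOp_sup_range_bbarSection_of_notMem
    (hplus : (Γ.plus j₀).Nondegenerate) (hΓ : Γ.Nondegenerate)
    (hdel : (Γ.delete j₀).Nondegenerate) (r : (Γ.delete j₀).OrbitRep) (k : (Γ.delete j₀).Char)
    (d : ℤ) {I : Finset J} (hI : I.card = q) (hj₀ : j₀ ∉ I) {t : Tower}
    (ht : (X : ℤ[X]) • t = 0) :
    Finsupp.single ⟨(deleteLine hΓ k d, I), hI⟩ t ∈ LinearMap.range (aOp hplus hΓ q) ⊔
      LinearMap.range (bbarSection (Γ.delete_isVertexDeletion j₀) hΓ r q) := by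
  set R := LinearMap.range (aOp hplus hΓ q) ⊔
    LinearMap.range (bbarSection (Γ.delete_isVertexDeletion j₀) hΓ r q)
  have add_succ_mem (s : ℤ) : Finsupp.single ⟨(deleteLine hΓ k s, I), hI⟩ t +
      Finsupp.single ⟨(deleteLine hΓ k (s + 1), I), hI⟩ t ∈ R := by
    refine Submodule.mem_sup_left ⟨_, (aOp_single hplus hΓ hdel k s hI ht {s, s + 1}
      fun d => ?_).trans (Finset.sum_pair (by omega))⟩
    rw [lineExp_eq_zero_iff_of_notMem hplus hΓ k hj₀, Finset.mem_insert, Finset.mem_singleton,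
      eq_comm, eq_comm (a := s + 1)]
  induction d using Int.induction_on with
  | zero =>
    obtain ⟨I₀, rfl⟩ := exists_map_eq_of_notMem (Γ.delete_isVertexDeletion j₀) hj₀
    refine Submodule.mem_sup_right ⟨Finsupp.single ⟨(k, I₀), (Finset.card_map _).symm.trans hI⟩
      (Bsign (Γ.delete j₀) Γ j₀ (OrderEmbedding.subtype (· ≠ j₀)) r k (Γ.e j₀) • t), ?_⟩
    rw [bbarSection_single, ← mul_smul, Bsign_mul_self, one_smul]
  | succ n ih => exact (Submodule.add_mem_iff_right R ih).1 (add_succ_mem n)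
  | pred n ih =>
    have := add_succ_mem (-n - 1)
    rw [sub_add_cancel] at this
    exact (Submodule.add_mem_iff_left R ih).1 this

theorem single_mem_range_aOp_of_mem (hplus : (Γ.plus j₀).Nondegenerate) (hΓ : Γ.Nondegenerate)
    (hdel : (Γ.delete j₀).Nondegenerate) (k : (Γ.delete j₀).Char) (d : ℤ) {I : Finset J}
    (hI : I.card = q) (hj₀ : j₀ ∈ I) {t : Tower} (ht : (X : ℤ[X]) • t = 0) :
    Finsupp.single ⟨(deleteLine hΓ k d, I), hI⟩ t ∈ LinearMap.range (aOp hplus hΓ q) := by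
  obtain ⟨C, hC⟩ := exists_lineExp_eq_zero_iff_of_mem hplus hΓ hdel k hj₀
  set R := LinearMap.range (aOp hplus hΓ q)
  set x : ℤ → Γ.Cochain q := fun d => Finsupp.single ⟨(deleteLine hΓ k d, I), hI⟩ t
  have sum_mem (s : ℤ) (S : Finset ℤ)
      (hS : ∀ d, (s = d ∨ (s < C ∧ s + 1 = d) ∨ (C < s ∧ s = d + 1)) ↔ d ∈ S) :
      ∑ d ∈ S, x d ∈ R :=
    ⟨_, aOp_single hplus hΓ hdel k s hI ht S fun d => (hC d s).trans (hS d)⟩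
  have center_mem : x C ∈ R := by
    have := sum_mem C {C} fun d => by rw [Finset.mem_singleton]; omega
    rwa [Finset.sum_singleton] at this
  change x d ∈ R
  rcases le_total C d with hd | hd
  · induction d, hd using Int.leInduction with
    | base => exact center_mem
    | succ d hd ih =>
      have := sum_mem (d + 1) {d, d + 1} fun d' => by
        rw [Finset.mem_insert, Finset.mem_singleton]; omega
      rw [Finset.sum_pair (by omega)] at this
      exact (Submodule.add_mem_iff_right R ih).1 this
  · induction d, hd using Int.leInductionDown with
    | base => exact center_mem
    | pred d hd ih =>
      have := sum_mem (d - 1) {d - 1, d} fun d' => by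
        rw [Finset.mem_insert, Finset.mem_singleton]; omega
      rw [Finset.sum_pair (by omega)] at this
      exact (Submodule.add_mem_iff_left R ih).1 this

theorem mem_range_aOp_sup_range_bbarSection (hplus : (Γ.plus j₀).Nondegenerate)
    (hΓ : Γ.Nondegenerate) (hdel : (Γ.delete j₀).Nondegenerate) (r : (Γ.delete j₀).OrbitRep)
    {ψ : Γ.Cochain q} (hψ : (X : ℤ[X]) • ψ = 0) :
    ψ ∈ LinearMap.range (aOp hplus hΓ q) ⊔
      LinearMap.range (bbarSection (Γ.delete_isVertexDeletion j₀) hΓ r q) := by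
  rw [← Finsupp.sum_single ψ]
  refine Submodule.sum_mem _ fun c _ => ?_
  have ht : (X : ℤ[X]) • ψ c = 0 := by rw [← Finsupp.smul_apply, hψ, Finsupp.zero_apply]
  obtain ⟨⟨K, I⟩, hI⟩ := c
  obtain ⟨k, d, rfl⟩ := exists_line (Γ.delete_isVertexDeletion j₀) hΓ hdel K
  by_cases hj₀ : j₀ ∈ I
  · exact Submodule.mem_sup_left (single_mem_range_aOp_of_mem hplus hΓ hdel k d hI hj₀ ht)
  · exact single_mem_range_aOp_sup_range_bbarSection_of_notMem hplus hΓ hdel r k d hI hj₀ ht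

theorem exact_aOp_bbarOp (hplus : (Γ.plus j₀).Nondegenerate) (hΓ : Γ.Nondegenerate)
    (hdel : (Γ.delete j₀).Nondegenerate) (r : (Γ.delete j₀).OrbitRep) :
    Function.Exact (aOp hplus hΓ q)
      (bbarOp (Γ.delete_isVertexDeletion j₀) hΓ hdel r q) := by
  refine exact_of_pow_torsion_of_divisible _ _ (bbarOp_aOp hplus hΓ hdel r)
    exists_X_pow_smul_eq_zero cochain_X_smul_surjective fun ψ hψ hBψ => ?_
  obtain ⟨_, ⟨φ, rfl⟩, _, ⟨χ, rfl⟩, rfl⟩ :=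
    Submodule.mem_sup.1 (mem_range_aOp_sup_range_bbarSection hplus hΓ hdel r hψ)
  rw [map_add, bbarOp_aOp, zero_add, bbarOp_bbarSection] at hBψ
  exact ⟨φ, by rw [hBψ, map_zero, add_zero]⟩

theorem Ahom_comp_BbarDelete (hplus : (Γ.plus j₀).Nondegenerate) (hΓ : Γ.Nondegenerate)
    (hdel : (Γ.delete j₀).Nondegenerate) (r : (Γ.delete j₀).OrbitRep) :
    Γ.Ahom j₀ hplus hΓ ≫ Γ.BbarDelete j₀ hΓ hdel r = 0 := by
  refine HomologicalComplex.hom_ext _ _ fun q => ?_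
  ext1
  exact LinearMap.ext fun φ => bbarOp_aOp hplus hΓ hdel r φ

theorem shortExact_Ahom_BbarDelete (hplus : (Γ.plus j₀).Nondegenerate) (hΓ : Γ.Nondegenerate)
    (hdel : (Γ.delete j₀).Nondegenerate) (r : (Γ.delete j₀).OrbitRep) :
    (ShortComplex.mk (Γ.Ahom j₀ hplus hΓ) (Γ.BbarDelete j₀ hΓ hdel r)
      (Ahom_comp_BbarDelete hplus hΓ hdel r)).ShortExact :=
  HomologicalComplex.shortExact_of_degreewise_shortExact _ fun _ =>
    ModuleCat.shortComplex_shortExact _ (exact_aOp_bbarOp hplus hΓ hdel r)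
      (aOp_injective hplus hΓ hdel)
      fun χ => ⟨_, bbarOp_bbarSection (Γ.delete_isVertexDeletion j₀) hΓ hdel r χ⟩

end Exactness

end PlumbingGraph

end

open CategoryTheory PlumbingGraph in
/-- The sequence `0 → ℱ^*(Γ_{j₀}^+) → ℱ^*(Γ) → ℱ^*(Γ ∖ j₀) → 0` with the maps `A^*`, `B̄^*` is a short
exact sequence of complexes of `ℤ[U]`-modules, and the induced long sequence of lattice cohomologies
(with the connecting homomorphisms of the short exact sequence) is exact; it begins with
`0 → ℍ^0(Γ_{j₀}^+)`. -/
theorem theorem5p6 {J : Type*} [Fintype J] [LinearOrder J] (Γ : PlumbingGraph J) (j₀ : J)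
    (hplus : (Γ.plus j₀).Nondegenerate) (hΓ : Γ.Nondegenerate)
    (hdel : (Γ.delete j₀).Nondegenerate) (r : (Γ.delete j₀).OrbitRep) :
    ∃ (hzero : Γ.Ahom j₀ hplus hΓ ≫ Γ.BbarDelete j₀ hΓ hdel r = 0)
      (hS : (ShortComplex.mk (Γ.Ahom j₀ hplus hΓ) (Γ.BbarDelete j₀ hΓ hdel r) hzero).ShortExact)
      (C : ∀ q : ℕ, (Γ.delete j₀).latticeCohomology q ⟶ (Γ.plus j₀).latticeCohomology (q + 1)),
      (∀ q, C q = hS.δ q (q + 1) rfl) ∧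
      Function.Injective (HomologicalComplex.homologyMap (Γ.Ahom j₀ hplus hΓ) 0).hom ∧
      ∀ q : ℕ,
        Function.Exact (HomologicalComplex.homologyMap (Γ.Ahom j₀ hplus hΓ) q).hom
          (HomologicalComplex.homologyMap (Γ.BbarDelete j₀ hΓ hdel r) q).hom ∧
        Function.Exact (HomologicalComplex.homologyMap (Γ.BbarDelete j₀ hΓ hdel r) q).hom
          (C q).hom ∧
        Function.Exact (C q).hom
          (HomologicalComplex.homologyMap (Γ.Ahom j₀ hplus hΓ) (q + 1)).hom := by
  have hS := shortExact_Ahom_BbarDelete hplus hΓ hdel r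
  have : Mono ((Γ.Ahom j₀ hplus hΓ).f 0) :=
    (ModuleCat.mono_iff_injective _).2 (aOp_injective hplus hΓ hdel)
  refine ⟨Ahom_comp_BbarDelete hplus hΓ hdel r, hS, fun q => hS.δ q (q + 1) rfl, fun _ => rfl,
    injective_homologyMap_zero _, fun q => ⟨?_, ?_, ?_⟩⟩
  · exact (ShortComplex.ShortExact.moduleCat_exact_iff_function_exact _).1 (hS.homology_exact₂ q)
  · exact (ShortComplex.ShortExact.moduleCat_exact_iff_function_exact _).1
      (hS.homology_exact₃ q (q + 1) rfl)
  · exact (ShortComplex.ShortExact.moduleCat_exact_iff_function_exact _).1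
      (hS.homology_exact₁ q (q + 1) rfl)
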